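/- Let $n \ge 2$ and let $C=(c_{ij})$ be the Cartan matrix of type $B_n$ with the Bourbaki labelling: $c_{ii}=2$, $c_{i,i+1}=c_{i+1,i}=-1$ for $1\le i\le n-1$, except that $c_{n-1,n}=-2$, and all other entries are $0$. Let $W$ be the finite Weyl group of type $B_n$, generated by the simple reflections $s_1,\dots,s_n$ and acting on the coroot lattice $R^\vee=\bigoplus_{i=1}^n\mathbb{Z}\alpha_i^\vee$ by $s_i(\alpha_j^\vee)=\alpha_j^\vee-c_{ij}\alpha_i^\vee$. Let $\beta=(\beta_1\ge\dots\ge\beta_p\ge 1)$ and $\gamma=(1\le\gamma_1\le\dots\le\gamma_q)$ be partitions with $|\beta|+|\gamma|=n$, where $p$ or $q$ may be $0$. Put $j^\beta_k=\beta_1+\dots+\beta_{k-1}$ and $j^\gamma_k=\gamma_1+\dots+\gamma_{k-1}$, and let $t_0=s_n$ and $t_i=s_{n-i}\,t_{i-1}\,s_{n-i}$ for $1\le i\le n-1$. Let $w_{\beta,\gamma}=w^\beta_1\cdots w^\beta_p\cdot w^\gamma_1\cdots w^\gamma_q\in W$, where \[ w^\beta_k=s_{j^\beta_k+1}s_{j^\beta_k+2}\cdots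 s_{j^\beta_k+\beta_k-1},\qquad w^\gamma_k=t_{j^\gamma_k}\,s_{n-(j^\gamma_k+1)}\,s_{n-(j^\gamma_k+2)}\cdots s_{n-(j^\gamma_k+\gamma_k)+1} \] (so $w^\beta_k=1$ if $\beta_k=1$, and $w^\gamma_k=t_{j^\gamma_k}$ if $\gamma_k=1$). Write $\gcd(\beta_k,2)=\gcd(\beta_1,\dots,\beta_p,2)$, which is $2$ if $p=0$, and, if $p\ge1$ and $\beta_p\ge 2$, write $\gcd(\beta_k,\beta_p-2)=\gcd(\beta_1,\dots,\beta_p,\beta_p-2)$. Write $\operatorname{diag}(\dots,a^r,\dots)$ for a diagonal matrix in which the entry $a$ is repeated $r$ times. Then the Smith normal form over $\mathbb{Z}$ of $\mathrm{Id}-w_{\beta,\gamma}$, acting on $R^\vee$ with basis $\alpha_1^\vee,\dots,\alpha_n^\vee$, is as follows. 1. If $\gcd(\beta_k,2)=2$, $|\gamma|\ge1$, and all parts of $\gamma$ have the same parity, it is $\operatorname{diag}(1^{n-q-p},2^q,0^p)$. 2. If $\gcd(\beta_k,2)=2$, $|\gamma|\ge1$, and $\gamma$ has two parts of different parity, it is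 $\operatorname{diag}(1^{n-q-p+1},2^{q-2},4,0^p)$. 3. If $\gcd(\beta_k,2)=1$ and $|\gamma|\ge1$, it is $\operatorname{diag}(1^{n-q-p+1},2^{q-1},0^p)$. 4. If $|\gamma|=0$, $\beta_p\ge2$, and $\gcd(\beta_k,\beta_p-2)\ge2$, it is $\operatorname{diag}(1^{n-p-1},\gcd(\beta_k,\beta_p-2),0^p)$. 5. If $|\gamma|=0$, and either $\beta_p=1$, or $\beta_p\ge2$ and $\gcd(\beta_k,\beta_p-2)=1$, it is $\operatorname{diag}(1^{n-p},0^p)$. -/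

import Mathlib

namespace TypeB

/-- The coroot lattice `R^∨ = ⨁ ℤ α_i^∨` of type `B_n`, in coordinates with respect to the simple
coroots `α_1^∨, …, α_n^∨`. The index `i : Fin n` stands for the node `i + 1` of the Dynkin
diagram; the special node is the last one. -/
abbrev CorootLattice (n : ℕ) : Type := Fin n → ℤ

/-- The simple coroot `α_{i+1}^∨`. -/
def simpleCoroot (n : ℕ) (i : Fin n) : CorootLattice n := Pi.single i 1

/-- The simple root `α_{i+1}` as a functional on the coroot lattice: its value at the `j`-th simple
coroot is the entry `c_{ij}` of the Cartan matrix of type `B_n`. -/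
def simpleRoot (n : ℕ) (i : Fin n) : Module.Dual ℤ (CorootLattice n) :=
  (LinearMap.proj i).comp (Matrix.mulVecLin (CartanMatrix.B n))

theorem simpleRoot_simpleCoroot (n : ℕ) (i j : Fin n) :
    simpleRoot n i (simpleCoroot n j) = CartanMatrix.B n i j := by
  simp [simpleRoot, simpleCoroot]

theorem simpleRoot_simpleCoroot_self (n : ℕ) (i : Fin n) :
    simpleRoot n i (simpleCoroot n i) = 2 := by
  rw [simpleRoot_simpleCoroot]
  simp [CartanMatrix.B]

/-- The simple reflection `v ↦ v - ⟨v, α_{i+1}⟩ α_{i+1}^∨` of the coroot lattice. -/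
noncomputable def simpleReflection (n : ℕ) (i : Fin n) :
    CorootLattice n ≃ₗ[ℤ] CorootLattice n :=
  Module.reflection (simpleRoot_simpleCoroot_self n i)

/-- On simple coroots, `s_i (α_j^∨) = α_j^∨ - c_{ij} α_i^∨`. -/
theorem simpleReflection_simpleCoroot (n : ℕ) (i j : Fin n) :
    simpleReflection n i (simpleCoroot n j) =
      simpleCoroot n j - CartanMatrix.B n i j • simpleCoroot n i := by
  rw [simpleReflection, Module.reflection_apply, simpleRoot_simpleCoroot]

/-- The finite Weyl group of type `B_n`, generated by the simple reflections and acting on the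
coroot lattice. -/
def weylGroup (n : ℕ) : Subgroup (CorootLattice n ≃ₗ[ℤ] CorootLattice n) :=
  Subgroup.closure (Set.range (simpleReflection n))

open Classical in
/-- The simple reflection `s_j` for the node `j ∈ {1, …, n}` (with the value `1` for other `j`,
which never occur below). -/
noncomputable def s (n j : ℕ) : weylGroup n :=
  if h : 1 ≤ j ∧ j ≤ n then
    ⟨simpleReflection n ⟨j - 1, by omega⟩, Subgroup.subset_closure (Set.mem_range_self _)⟩
  else 1

/-- The elements `t_0 = s_n` and `t_i = s_{n-i} t_{i-1} s_{n-i}`. -/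
noncomputable def t (n : ℕ) : ℕ → weylGroup n
  | 0 => s n n
  | i + 1 => s n (n - (i + 1)) * t n i * s n (n - (i + 1))

/-- The sum of the parts of `a` that come strictly before the part with index `k`. -/
def partialSum {r : ℕ} (a : Fin r → ℕ) (k : Fin r) : ℕ := ∑ i with i < k, a i

/-- The positive block `s_{j+1} s_{j+2} ⋯ s_{j+b-1}` of length `b` starting at `j`. -/
noncomputable def positiveBlock (n j b : ℕ) : weylGroup n :=
  (List.ofFn fun l : Fin (b - 1) => s n (j + 1 + l)).prod

/-- The negative block `t_j s_{n-(j+1)} s_{n-(j+2)} ⋯ s_{n-(j+c)+1}` of length `c` starting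
at `j`. -/
noncomputable def negativeBlock (n j c : ℕ) : weylGroup n :=
  t n j * (List.ofFn fun l : Fin (c - 1) => s n (n - (j + 1 + l))).prod

/-- The product, in the order of the parts, of the positive blocks given by the parts of `β`. -/
noncomputable def wBeta (n : ℕ) {p : ℕ} (β : Fin p → ℕ) : weylGroup n :=
  (List.ofFn fun k : Fin p => positiveBlock n (partialSum β k) (β k)).prod

/-- The product, in the order of the parts, of the negative blocks given by the parts of `γ`. -/
noncomputable def wGamma (n : ℕ) {q : ℕ} (γ : Fin q → ℕ) : weylGroup n :=
  (List.ofFn fun k : Fin q => negativeBlock n (partialSum γ k) (γ k)).prod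

/-- The conjugacy class representative `w_{β,γ} = w_β w_γ`. -/
noncomputable def wRep (n : ℕ) {p q : ℕ} (β : Fin p → ℕ) (γ : Fin q → ℕ) : weylGroup n :=
  wBeta n β * wGamma n γ

/-- The matrix of `Id - w`, acting on the coroot lattice, in the basis of simple coroots. -/
noncomputable def idSubMatrix {n : ℕ} (w : weylGroup n) : Matrix (Fin n) (Fin n) ℤ :=
  LinearMap.toMatrix' (LinearMap.id - (w : CorootLattice n ≃ₗ[ℤ] CorootLattice n).toLinearMap)

/-- The last part of `β` (with the value `0` if `β` has no parts). -/
def lastPart : {p : ℕ} → (Fin p → ℕ) → ℕ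
  | 0, _ => 0
  | p + 1, β => β (Fin.last p)

/-- The greatest common divisor of all parts of `β`; it is `0` if `β` has no parts. -/
def gcdParts {p : ℕ} (β : Fin p → ℕ) : ℕ := Finset.univ.gcd β

end TypeB

/-- The square integer matrix `A` has Smith normal form `diag(d)`: the entries of `d` are
nonnegative, each divides all later ones, there are as many as the size of `A`, and `A` becomes
the diagonal matrix with these entries after multiplication on both sides by matrices that are
invertible over `ℤ`. -/
def HasSmithNormalForm {n : ℕ} (A : Matrix (Fin n) (Fin n) ℤ) (d : List ℕ) : Prop :=
  ∃ h : d.length = n, d.Pairwise (· ∣ ·) ∧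
    ∃ P Q : Matrix (Fin n) (Fin n) ℤ, IsUnit P ∧ IsUnit Q ∧
      P * A * Q = Matrix.diagonal fun i : Fin n => ((d.get (i.cast h.symm) : ℕ) : ℤ)

/-!
In the standard realization of type `B_n` the coroot lattice is the lattice of vectors in `ℤⁿ` with
even coordinate sum, and `w = w_{β,γ}` is a signed permutation of the coordinate vectors with
positive cycles of lengths `β_k` and negative cycles of lengths `γ_k`. On all of `ℤⁿ` the map
`f = 1 - w` is easy to diagonalize. For a cycle `e_0 ↦ e_1 ↦ ⋯ ↦ e_{b-1} ↦ ± e_0`, the vectors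
`x_i = e_i` with `i + 1 < b` go to `y_i = e_i - e_{i+1}`; the sum of the `e_i` is killed if the
cycle is positive, and goes to `2 e_0` if it is negative. The `x_i` and the cycle sums form a basis
of `ℤⁿ`, and so do the `y_i` together with one `e_j` from each cycle (`CycleFamilies`).

The coordinate sum `σ` takes the value `1` on the `x_i`, the cycle length on the cycle sums, `0` on
the `y_i` and `1` on the `e_j`. A sublattice `{σ even}` is generated by twice a pivot `w₀` with `σ`
odd and by the members of a basis, each corrected by a multiple of `w₀` (`evenPart_le`). Choosing
the pivots in source and target according to the parities of the cycle lengths gives, in each case,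
two families that span the even sublattice and in which `f` is diagonal. The pivot in the source is
an odd positive cycle sum if there is one, otherwise an odd negative cycle sum if there is one, and
otherwise one of the `x_i`. These are the lemmas `CycleFamilies.isDiagonalizedBy_of_*`. The factor
`4` for mixed parities comes from `f (2 v₁ - 2 v₀) = 4 (z₁ - z₀)`, where `v₁` and `v₀` are an odd
and an even negative cycle sum, with `f v_i = 2 z_i`.

A spanning family of `ℤⁿ` with `n` members is a basis, so only spanning has to be checked
(`hasSmithNormalForm_of_span`). Instead of the ambient `ℤⁿ` its double is used, which lies inside
the coroot lattice: `twiceCoord n k` is `2 e_k` in terms of simple coroots. The sublattice with `σ`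
even is then twice the coroot lattice (`mem_evenPart_span_twiceCoord`), and families in it are
halved at the end (`IsDiagonalizedBy.hasSmithNormalForm`).
-/

/-! ### Smith normal forms from spanning families -/

/-- The diagonal of a Smith normal form may be read off from a finite family of diagonal entries
in any order. -/
theorem exists_equiv_get {ι : Type*} [Fintype ι] (D : ι → ℕ) (d : List ℕ)
    (h : ∑ i, ({D i} : Multiset ℕ) = (d : Multiset ℕ)) :
    ∃ e : Fin d.length ≃ ι, ∀ i, D (e i) = d.get i := by
  have hD : Finset.univ.val.map D = (Finset.univ : Finset (Fin d.length)).val.map d.get := by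
    rw [Fin.univ_val_map, List.ofFn_get, ← h]
    exact (Multiset.sum_map_singleton _).symm.trans (by rw [Multiset.map_map]; rfl)
  have hcard (c : ℕ) : Nonempty ({i : Fin d.length // d.get i = c} ≃ {i : ι // D i = c}) := by
    classical
    refine ⟨Fintype.equivOfCardEq ?_⟩
    have := congrArg (Multiset.count c) hD
    rw [Multiset.count_map, Multiset.count_map] at this
    rw [Fintype.card_subtype, Fintype.card_subtype, Finset.card_def, Finset.card_def,
      Finset.filter_val, Finset.filter_val]
    simpa only [eq_comm] using this.symm
  let e (c : ℕ) := (hcard c).some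
  exact ⟨Equiv.ofFiberEquiv e, fun i => Equiv.ofFiberEquiv_map e i⟩

open scoped Matrix in
theorem isUnit_of_span_columns {n : ℕ} (S : Fin n → Fin n → ℤ)
    (hS : Submodule.span ℤ (Set.range S) = ⊤) : IsUnit (Matrix.of S)ᵀ := by
  rw [← Matrix.mulVec_surjective_iff_isUnit]
  intro v
  have hv : v ∈ Submodule.span ℤ (Set.range S) := hS ▸ Submodule.mem_top
  obtain ⟨c, rfl⟩ := (Submodule.mem_span_range_iff_exists_fun ℤ).1 hv
  refine ⟨c, ?_⟩
  ext a
  simp [Matrix.mulVec, dotProduct, mul_comm]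

open scoped Matrix in
/-- A square matrix over `ℤ` that maps the members of one spanning family to multiples of the
members of another has these multiples as its Smith normal form, provided that the families have
as many members as the matrix has columns: such families are automatically bases. -/
theorem hasSmithNormalForm_of_span {n : ℕ} {ι : Type*} [Fintype ι] (A : Matrix (Fin n) (Fin n) ℤ)
    (d : List ℕ) (hlen : d.length = n) (hdvd : d.Pairwise (· ∣ ·)) (D : ι → ℕ)
    (hD : ∑ i, ({D i} : Multiset ℕ) = (d : Multiset ℕ)) (S T : ι → Fin n → ℤ)
    (hS : Submodule.span ℤ (Set.range S) = ⊤) (hT : Submodule.span ℤ (Set.range T) = ⊤)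
    (h : ∀ i, A *ᵥ S i = (D i : ℤ) • T i) : HasSmithNormalForm A d := by
  subst hlen
  obtain ⟨e, he⟩ := exists_equiv_get D d hD
  have hS' := isUnit_of_span_columns (S ∘ e) (by rwa [e.surjective.range_comp])
  have hT' := isUnit_of_span_columns (T ∘ e) (by rwa [e.surjective.range_comp])
  refine ⟨rfl, hdvd, (Matrix.of (T ∘ e))ᵀ⁻¹, (Matrix.of (S ∘ e))ᵀ,
    (Matrix.isUnit_nonsing_inv_iff).2 hT', hS', ?_⟩
  have key : A * (Matrix.of (S ∘ e))ᵀ =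
      (Matrix.of (T ∘ e))ᵀ * Matrix.diagonal fun i => ((d.get i : ℕ) : ℤ) := by
    ext a i
    have := congrFun (h (e i)) a
    rw [he] at this
    rw [Matrix.mul_diagonal, mul_comm]
    exact this
  rw [mul_assoc, key, ← mul_assoc, Matrix.nonsing_inv_mul _ ((Matrix.isUnit_iff_isUnit_det _).1 hT'),
    one_mul]
  rfl

/-! ### Diagonal families in an even sublattice -/

section CycleFamilies

variable {M : Type*} [AddCommGroup M] {f : M →ₗ[ℤ] M} {σ : M →ₗ[ℤ] ℤ} {N : Submodule ℤ M}
  {X P Q : Type*} {β : P → ℤ} {γ : Q → ℤ}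

/-- The elements of `N` on which `σ` is even. -/
def evenPart (σ : M →ₗ[ℤ] ℤ) (N : Submodule ℤ M) : Submodule ℤ M :=
  N ⊓ (Submodule.span ℤ {(2 : ℤ)}).comap σ

theorem mem_evenPart {v : M} : v ∈ evenPart σ N ↔ v ∈ N ∧ (2 : ℤ) ∣ σ v := by
  rw [evenPart, Submodule.mem_inf, Submodule.mem_comap]
  exact and_congr_right fun _ => Ideal.mem_span_singleton

/-- If `s` spans `N`, then the even part of `N` is generated by twice a pivot `w` together with
the members of `s`, each corrected by a multiple of `w` of the right parity. -/
theorem evenPart_le {ι : Type*} {s : ι → M} (hs : N ≤ Submodule.span ℤ (Set.range s))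
    {K : Submodule ℤ M} (w : M) (hw : (2 : ℤ) • w ∈ K) (a : ι → ℤ)
    (ha : ∀ i, (2 : ℤ) ∣ σ (s i) - a i) (h : ∀ i, s i - a i • w ∈ K) : evenPart σ N ≤ K := by
  have key : ∀ v ∈ Submodule.span ℤ (Set.range s), ∃ c : ℤ, (2 : ℤ) ∣ σ v - c ∧ v - c • w ∈ K := by
    intro v hv
    induction hv using Submodule.span_induction with
    | mem v hv =>
      obtain ⟨i, rfl⟩ := hv
      exact ⟨a i, ha i, h i⟩
    | zero => exact ⟨0, by simp, by simp⟩
    | add v v' _ _ hv hv' =>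
      obtain ⟨c, h1, h2⟩ := hv
      obtain ⟨c', h1', h2'⟩ := hv'
      refine ⟨c + c', by rw [map_add]; omega, ?_⟩
      convert K.add_mem h2 h2' using 1
      module
    | smul m v _ hv =>
      obtain ⟨c, h1, h2⟩ := hv
      refine ⟨m * c, ?_, ?_⟩
      · rw [map_smul, smul_eq_mul, ← mul_sub]
        exact h1.mul_left m
      · convert K.smul_mem m h2 using 1
        module
  intro v hv
  obtain ⟨hvN, hv2⟩ := mem_evenPart.1 hv
  obtain ⟨c, h1, h2⟩ := key v (hs hvN)
  obtain ⟨b, rfl⟩ : (2 : ℤ) ∣ c := by omega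
  convert K.add_mem h2 (K.smul_mem b hw) using 1
  module

/-- `f` maps the members of a spanning family of `E` to the multiples with coefficients `D` of the
members of another spanning family of `E`. -/
def IsDiagonalizedBy {ι : Type*} (f : M →ₗ[ℤ] M) (E : Submodule ℤ M) (D : ι → ℕ) : Prop :=
  ∃ S T : ι → M, Submodule.span ℤ (Set.range S) = E ∧ Submodule.span ℤ (Set.range T) = E ∧
    ∀ i, f (S i) = (D i : ℤ) • T i

/-- Two families spanning `N`, adapted to the endomorphism `f = 1 - w` of a signed permutation `w`:
`P` indexes the positive cycles (with lengths `β`), `Q` the negative cycles (with lengths `γ`), and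
`X` the basis vectors that are not last in their cycle. The functional `σ` is the sum of the
coordinates. -/
structure CycleFamilies (f : M →ₗ[ℤ] M) (σ : M →ₗ[ℤ] ℤ) (N : Submodule ℤ M)
    (X : Type*) {P Q : Type*} (β : P → ℤ) (γ : Q → ℤ) where
  /-- The basis vectors that are not last in their cycle. -/
  x : X → M
  /-- The sums over the positive cycles. -/
  u : P → M
  /-- The sums over the negative cycles. -/
  v : Q → M
  /-- The differences of consecutive basis vectors in a cycle. -/
  y : X → M
  /-- One basis vector from each positive cycle. -/
  r : P → M
  /-- The first basis vector of each negative cycle. -/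
  z : Q → M
  f_x : ∀ a, f (x a) = y a
  f_u : ∀ i, f (u i) = 0
  f_v : ∀ k, f (v k) = (2 : ℤ) • z k
  σ_x : ∀ a, σ (x a) = 1
  σ_u : ∀ i, σ (u i) = β i
  σ_v : ∀ k, σ (v k) = γ k
  σ_y : ∀ a, σ (y a) = 0
  σ_r : ∀ i, σ (r i) = 1
  σ_z : ∀ k, σ (z k) = 1
  span_source : Submodule.span ℤ (Set.range (Sum.elim x (Sum.elim u v))) = N
  span_target : Submodule.span ℤ (Set.range (Sum.elim y (Sum.elim r z))) = N

namespace CycleFamilies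

theorem x_mem (F : CycleFamilies f σ N X β γ) (a : X) : F.x a ∈ N :=
  F.span_source.le (Submodule.subset_span ⟨Sum.inl a, rfl⟩)

theorem u_mem (F : CycleFamilies f σ N X β γ) (i : P) : F.u i ∈ N :=
  F.span_source.le (Submodule.subset_span ⟨Sum.inr (Sum.inl i), rfl⟩)

theorem v_mem (F : CycleFamilies f σ N X β γ) (k : Q) : F.v k ∈ N :=
  F.span_source.le (Submodule.subset_span ⟨Sum.inr (Sum.inr k), rfl⟩)

theorem y_mem (F : CycleFamilies f σ N X β γ) (a : X) : F.y a ∈ N :=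
  F.span_target.le (Submodule.subset_span ⟨Sum.inl a, rfl⟩)

theorem r_mem (F : CycleFamilies f σ N X β γ) (i : P) : F.r i ∈ N :=
  F.span_target.le (Submodule.subset_span ⟨Sum.inr (Sum.inl i), rfl⟩)

theorem z_mem (F : CycleFamilies f σ N X β γ) (k : Q) : F.z k ∈ N :=
  F.span_target.le (Submodule.subset_span ⟨Sum.inr (Sum.inr k), rfl⟩)

theorem span_eq_of_source (F : CycleFamilies f σ N X β γ) {ι : Type*} {S : ι → M}
    (hS : ∀ i, S i ∈ evenPart σ N) (w : M) (a : X → ℤ) (b : P → ℤ) (c : Q → ℤ)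
    (ha : ∀ i, (2 : ℤ) ∣ 1 - a i) (hb : ∀ i, (2 : ℤ) ∣ β i - b i)
    (hc : ∀ i, (2 : ℤ) ∣ γ i - c i)
    (h : (2 : ℤ) • w ∈ Submodule.span ℤ (Set.range S) ∧
      (∀ i, F.x i - a i • w ∈ Submodule.span ℤ (Set.range S)) ∧
      (∀ i, F.u i - b i • w ∈ Submodule.span ℤ (Set.range S)) ∧
      ∀ i, F.v i - c i • w ∈ Submodule.span ℤ (Set.range S)) :
    Submodule.span ℤ (Set.range S) = evenPart σ N := by
  refine le_antisymm (Submodule.span_le.2 ?_) ?_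
  · rintro _ ⟨i, rfl⟩
    exact hS i
  · refine evenPart_le F.span_source.ge w h.1 (Sum.elim a (Sum.elim b c)) ?_ ?_
    · rintro (i | i | i)
      · simpa [F.σ_x] using ha i
      · simpa [F.σ_u] using hb i
      · simpa [F.σ_v] using hc i
    · rintro (i | i | i)
      exacts [h.2.1 i, h.2.2.1 i, h.2.2.2 i]

theorem span_eq_of_target (F : CycleFamilies f σ N X β γ) {ι : Type*} {T : ι → M}
    (hT : ∀ i, T i ∈ evenPart σ N) (w : M)
    (h : (2 : ℤ) • w ∈ Submodule.span ℤ (Set.range T) ∧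
      (∀ i, F.y i ∈ Submodule.span ℤ (Set.range T)) ∧
      (∀ i, F.r i - w ∈ Submodule.span ℤ (Set.range T)) ∧
      ∀ i, F.z i - w ∈ Submodule.span ℤ (Set.range T)) :
    Submodule.span ℤ (Set.range T) = evenPart σ N := by
  refine le_antisymm (Submodule.span_le.2 ?_) ?_
  · rintro _ ⟨i, rfl⟩
    exact hT i
  · refine evenPart_le F.span_target.ge w h.1
      (Sum.elim (fun _ => 0) (Sum.elim (fun _ => 1) fun _ => 1)) ?_ ?_
    · rintro (i | i | i)
      · simp [F.σ_y]
      · simp [F.σ_r]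
      · simp [F.σ_z]
    · rintro (i | i | i)
      · simpa using h.2.1 i
      · simpa using h.2.2.1 i
      · simpa using h.2.2.2 i

theorem two_dvd_sub_mul {b : ℤ} (hb : b % 2 = 1) (c : ℤ) : (2 : ℤ) ∣ c - c * b := by
  rw [← mul_one_sub]
  exact Dvd.dvd.mul_left (by omega) c

/-- A positive cycle of odd length and at least one negative cycle: the sum `u i₀` over the odd
cycle is a pivot of odd parity that `f` kills. -/
theorem isDiagonalizedBy_of_odd [DecidableEq P] [DecidableEq Q] (F : CycleFamilies f σ N X β γ)
    (i₀ : P) (hi₀ : β i₀ % 2 = 1) (k₀ : Q) :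
    IsDiagonalizedBy f (evenPart σ N) (Sum.elim (fun _ : X => 1)
      (Sum.elim (fun _ : P => 0) fun k => if k = k₀ then 1 else 2)) := by
  let S : X ⊕ P ⊕ Q → M := Sum.elim (fun a => F.x a - F.u i₀)
    (Sum.elim (fun i => if i = i₀ then (2 : ℤ) • F.u i₀ else F.u i - β i • F.u i₀)
      fun k => if k = k₀ then F.v k₀ - γ k₀ • F.u i₀
        else F.v k - F.v k₀ - (γ k - γ k₀) • F.u i₀)
  let T : X ⊕ P ⊕ Q → M := Sum.elim F.y (Sum.elim (fun i => F.r i - F.z k₀)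
    fun k => if k = k₀ then (2 : ℤ) • F.z k₀ else F.z k - F.z k₀)
  have hS i : S i ∈ Submodule.span ℤ (Set.range S) := Submodule.subset_span ⟨i, rfl⟩
  have hT i : T i ∈ Submodule.span ℤ (Set.range T) := Submodule.subset_span ⟨i, rfl⟩
  have hu := two_dvd_sub_mul hi₀
  refine ⟨S, T, F.span_eq_of_source ?_ (F.u i₀) (fun _ => 1) β γ (by simp) (by simp) (by simp)
    ⟨by simpa [S] using hS (.inr (.inl i₀)), fun a => by simpa [S] using hS (.inl a),
      fun i => ?_, fun k => ?_⟩,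
    F.span_eq_of_target ?_ (F.z k₀) ⟨by simpa [T] using hT (.inr (.inr k₀)),
      fun a => hT (.inl a), fun i => hT (.inr (.inl i)), fun k => ?_⟩, ?_⟩
  · rintro (a | i | k)
    · refine mem_evenPart.2 ⟨N.sub_mem (F.x_mem a) (F.u_mem _), ?_⟩
      simp only [S, Sum.elim_inl, map_sub, F.σ_x, F.σ_u]
      omega
    · simp only [S, Sum.elim_inl, Sum.elim_inr]
      split_ifs
      · exact mem_evenPart.2 ⟨N.smul_mem _ (F.u_mem _), by simp⟩
      · refine mem_evenPart.2 ⟨N.sub_mem (F.u_mem _) (N.smul_mem _ (F.u_mem _)), ?_⟩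
        simpa [F.σ_u] using hu (β i)
    · simp only [S, Sum.elim_inr]
      split_ifs
      · refine mem_evenPart.2 ⟨N.sub_mem (F.v_mem _) (N.smul_mem _ (F.u_mem _)), ?_⟩
        simpa [F.σ_u, F.σ_v] using hu (γ k₀)
      · refine mem_evenPart.2 ⟨N.sub_mem (N.sub_mem (F.v_mem _) (F.v_mem _))
          (N.smul_mem _ (F.u_mem _)), ?_⟩
        simpa [F.σ_u, F.σ_v] using hu (γ k - γ k₀)
  · by_cases hi : i = i₀
    · subst hi
      obtain ⟨c, hc⟩ : (2 : ℤ) ∣ 1 - β i := by omega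
      convert Submodule.smul_mem _ c (hS (.inr (.inl i))) using 1
      simp only [S, Sum.elim_inl, Sum.elim_inr, if_true]
      rw [show β i = 1 - 2 * c by omega]
      module
    · simpa [S, hi] using hS (.inr (.inl i))
  · have h₀ : F.v k₀ - γ k₀ • F.u i₀ ∈ Submodule.span ℤ (Set.range S) := by
      simpa [S] using hS (.inr (.inr k₀))
    by_cases hk : k = k₀
    · rwa [hk]
    · convert Submodule.add_mem _ h₀ (hS (.inr (.inr k))) using 1
      simp only [S, Sum.elim_inr, hk, if_false]
      module
  · rintro (a | i | k)
    · exact mem_evenPart.2 ⟨F.y_mem a, by simp [T, F.σ_y]⟩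
    · exact mem_evenPart.2 ⟨N.sub_mem (F.r_mem i) (F.z_mem _), by simp [T, F.σ_r, F.σ_z]⟩
    · simp only [T, Sum.elim_inr]
      split_ifs
      · exact mem_evenPart.2 ⟨N.smul_mem _ (F.z_mem _), by simp⟩
      · exact mem_evenPart.2 ⟨N.sub_mem (F.z_mem _) (F.z_mem _), by simp [F.σ_z]⟩
  · by_cases hk : k = k₀
    · simp [hk]
    · simpa [T, hk] using hT (.inr (.inr k))
  · rintro (a | i | k)
    · simp [S, T, F.f_x, F.f_u]
    · simp only [S, T, Sum.elim_inl, Sum.elim_inr]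
      split_ifs <;> simp [F.f_u]
    · simp only [S, T, Sum.elim_inr]
      split_ifs <;> simp [F.f_u, F.f_v, smul_sub]

/-- A positive cycle of odd length and no negative cycles. -/
theorem isDiagonalizedBy_of_odd_of_isEmpty [DecidableEq P] [IsEmpty Q]
    (F : CycleFamilies f σ N X β γ) (i₀ : P) (hi₀ : β i₀ % 2 = 1) :
    IsDiagonalizedBy f (evenPart σ N) (Sum.elim (fun _ : X => 1)
      (Sum.elim (fun _ : P => 0) fun _ : Q => 2)) := by
  let S : X ⊕ P ⊕ Q → M := Sum.elim (fun a => F.x a - F.u i₀)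
    (Sum.elim (fun i => if i = i₀ then (2 : ℤ) • F.u i₀ else F.u i - β i • F.u i₀) F.v)
  let T : X ⊕ P ⊕ Q → M := Sum.elim F.y
    (Sum.elim (fun i => if i = i₀ then (2 : ℤ) • F.r i₀ else F.r i - F.r i₀) F.z)
  have hS i : S i ∈ Submodule.span ℤ (Set.range S) := Submodule.subset_span ⟨i, rfl⟩
  have hT i : T i ∈ Submodule.span ℤ (Set.range T) := Submodule.subset_span ⟨i, rfl⟩
  have hu := two_dvd_sub_mul hi₀
  refine ⟨S, T, F.span_eq_of_source ?_ (F.u i₀) (fun _ => 1) β γ (by simp) (by simp) (by simp)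
    ⟨by simpa [S] using hS (.inr (.inl i₀)), fun a => by simpa [S] using hS (.inl a),
      fun i => ?_, isEmptyElim⟩,
    F.span_eq_of_target ?_ (F.r i₀) ⟨by simpa [T] using hT (.inr (.inl i₀)),
      fun a => hT (.inl a), fun i => ?_, isEmptyElim⟩, ?_⟩
  · rintro (a | i | k)
    · refine mem_evenPart.2 ⟨N.sub_mem (F.x_mem a) (F.u_mem _), ?_⟩
      simp only [S, Sum.elim_inl, map_sub, F.σ_x, F.σ_u]
      omega
    · simp only [S, Sum.elim_inl, Sum.elim_inr]
      split_ifs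
      · exact mem_evenPart.2 ⟨N.smul_mem _ (F.u_mem _), by simp⟩
      · refine mem_evenPart.2 ⟨N.sub_mem (F.u_mem _) (N.smul_mem _ (F.u_mem _)), ?_⟩
        simpa [F.σ_u] using hu (β i)
    · exact isEmptyElim k
  · by_cases hi : i = i₀
    · subst hi
      obtain ⟨c, hc⟩ : (2 : ℤ) ∣ 1 - β i := by omega
      convert Submodule.smul_mem _ c (hS (.inr (.inl i))) using 1
      simp only [S, Sum.elim_inl, Sum.elim_inr, if_true]
      rw [show β i = 1 - 2 * c by omega]
      module
    · simpa [S, hi] using hS (.inr (.inl i))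
  · rintro (a | i | k)
    · exact mem_evenPart.2 ⟨F.y_mem a, by simp [T, F.σ_y]⟩
    · simp only [T, Sum.elim_inl, Sum.elim_inr]
      split_ifs
      · exact mem_evenPart.2 ⟨N.smul_mem _ (F.r_mem _), by simp⟩
      · exact mem_evenPart.2 ⟨N.sub_mem (F.r_mem _) (F.r_mem _), by simp [F.σ_r]⟩
    · exact isEmptyElim k
  · by_cases hi : i = i₀
    · simp [hi]
    · simpa [T, hi] using hT (.inr (.inl i))
  · rintro (a | i | k)
    · simp [S, T, F.f_x, F.f_u]
    · simp only [S, T, Sum.elim_inl, Sum.elim_inr]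
      split_ifs <;> simp [F.f_u]
    · exact isEmptyElim k

/-- All positive cycles of even length and all negative cycles of odd length: the sum over a
negative cycle is the pivot. -/
theorem isDiagonalizedBy_of_even_of_odd [DecidableEq Q] (F : CycleFamilies f σ N X β γ)
    (hβ : ∀ i, β i % 2 = 0) (hγ : ∀ k, γ k % 2 = 1) (k₀ : Q) :
    IsDiagonalizedBy f (evenPart σ N) (Sum.elim (fun _ : X => 1)
      (Sum.elim (fun _ : P => 0) fun _ : Q => 2)) := by
  let S : X ⊕ P ⊕ Q → M := Sum.elim (fun a => F.x a - F.v k₀)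
    (Sum.elim F.u fun k => if k = k₀ then (2 : ℤ) • F.v k₀ else F.v k - F.v k₀)
  let T : X ⊕ P ⊕ Q → M := Sum.elim (fun a => F.y a - (2 : ℤ) • F.z k₀)
    (Sum.elim (fun i => F.r i - F.z k₀)
      fun k => if k = k₀ then (2 : ℤ) • F.z k₀ else F.z k - F.z k₀)
  have hS i : S i ∈ Submodule.span ℤ (Set.range S) := Submodule.subset_span ⟨i, rfl⟩
  have hT i : T i ∈ Submodule.span ℤ (Set.range T) := Submodule.subset_span ⟨i, rfl⟩
  have hT₀ : (2 : ℤ) • F.z k₀ ∈ Submodule.span ℤ (Set.range T) := by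
    simpa [T] using hT (.inr (.inr k₀))
  refine ⟨S, T, F.span_eq_of_source ?_ (F.v k₀) (fun _ => 1) (fun _ => 0) (fun _ => 1) (by simp)
    (fun i => ?_) (fun k => ?_) ⟨by simpa [S] using hS (.inr (.inr k₀)),
      fun a => by simpa [S] using hS (.inl a), fun i => by simpa [S] using hS (.inr (.inl i)),
      fun k => ?_⟩,
    F.span_eq_of_target ?_ (F.z k₀) ⟨hT₀, fun a => ?_, fun i => hT (.inr (.inl i)), fun k => ?_⟩,
    ?_⟩
  · rintro (a | i | k)
    · refine mem_evenPart.2 ⟨N.sub_mem (F.x_mem a) (F.v_mem _), ?_⟩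
      simp only [S, Sum.elim_inl, map_sub, F.σ_x, F.σ_v]
      have := hγ k₀
      omega
    · refine mem_evenPart.2 ⟨F.u_mem i, ?_⟩
      simp only [S, Sum.elim_inl, Sum.elim_inr, F.σ_u]
      exact Int.dvd_of_emod_eq_zero (hβ i)
    · simp only [S, Sum.elim_inr]
      split_ifs
      · exact mem_evenPart.2 ⟨N.smul_mem _ (F.v_mem _), by simp⟩
      · refine mem_evenPart.2 ⟨N.sub_mem (F.v_mem _) (F.v_mem _), ?_⟩
        rw [map_sub, F.σ_v, F.σ_v]
        have := hγ k₀
        have := hγ k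
        omega
  · have := hβ i
    omega
  · have := hγ k
    omega
  · by_cases hk : k = k₀
    · simp [hk]
    · simpa [S, hk] using hS (.inr (.inr k))
  · rintro (a | i | k)
    · exact mem_evenPart.2 ⟨N.sub_mem (F.y_mem a) (N.smul_mem _ (F.z_mem _)),
        by simp [T, F.σ_y]⟩
    · exact mem_evenPart.2 ⟨N.sub_mem (F.r_mem i) (F.z_mem _), by simp [T, F.σ_r, F.σ_z]⟩
    · simp only [T, Sum.elim_inr]
      split_ifs
      · exact mem_evenPart.2 ⟨N.smul_mem _ (F.z_mem _), by simp⟩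
      · exact mem_evenPart.2 ⟨N.sub_mem (F.z_mem _) (F.z_mem _), by simp [F.σ_z]⟩
  · simpa [T] using Submodule.add_mem _ (hT (.inl a)) hT₀
  · by_cases hk : k = k₀
    · simp [hk]
    · simpa [T, hk] using hT (.inr (.inr k))
  · rintro (a | i | k)
    · simp [S, T, F.f_x, F.f_v]
    · simp [S, F.f_u]
    · simp only [S, T, Sum.elim_inr]
      split_ifs <;> simp [F.f_v, smul_sub]

/-- All cycles of even length, at least one of them negative: the pivot is a basis vector `x a₀`,
which exists since even cycles have length at least `2`. -/
theorem isDiagonalizedBy_of_even_of_even [DecidableEq X] [DecidableEq Q]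
    (F : CycleFamilies f σ N X β γ) (hβ : ∀ i, β i % 2 = 0) (hγ : ∀ k, γ k % 2 = 0) (a₀ : X)
    (k₀ : Q) :
    IsDiagonalizedBy f (evenPart σ N) (Sum.elim (fun a : X => if a = a₀ then 2 else 1)
      (Sum.elim (fun _ : P => 0) fun k : Q => if k = k₀ then 1 else 2)) := by
  let S : X ⊕ P ⊕ Q → M :=
    Sum.elim (fun a => if a = a₀ then (2 : ℤ) • F.x a₀ else F.x a - F.x a₀)
      (Sum.elim F.u fun k => if k = k₀ then F.v k₀ else F.v k - F.v k₀)
  let T : X ⊕ P ⊕ Q → M := Sum.elim (fun a => if a = a₀ then F.y a₀ else F.y a - F.y a₀)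
    (Sum.elim (fun i => F.r i - F.z k₀)
      fun k => if k = k₀ then (2 : ℤ) • F.z k₀ else F.z k - F.z k₀)
  have hS i : S i ∈ Submodule.span ℤ (Set.range S) := Submodule.subset_span ⟨i, rfl⟩
  have hT i : T i ∈ Submodule.span ℤ (Set.range T) := Submodule.subset_span ⟨i, rfl⟩
  have hS₀ : F.v k₀ ∈ Submodule.span ℤ (Set.range S) := by simpa [S] using hS (.inr (.inr k₀))
  have hT₀ : F.y a₀ ∈ Submodule.span ℤ (Set.range T) := by simpa [T] using hT (.inl a₀)
  refine ⟨S, T, F.span_eq_of_source ?_ (F.x a₀) (fun _ => 1) (fun _ => 0) (fun _ => 0) (by simp)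
    (fun i => ?_) (fun k => ?_) ⟨by simpa [S] using hS (.inl a₀),
      fun a => ?_, fun i => by simpa [S] using hS (.inr (.inl i)), fun k => ?_⟩,
    F.span_eq_of_target ?_ (F.z k₀) ⟨by simpa [T] using hT (.inr (.inr k₀)), fun a => ?_,
      fun i => hT (.inr (.inl i)), fun k => ?_⟩, ?_⟩
  · rintro (a | i | k)
    · simp only [S, Sum.elim_inl]
      split_ifs
      · exact mem_evenPart.2 ⟨N.smul_mem _ (F.x_mem _), by simp⟩
      · exact mem_evenPart.2 ⟨N.sub_mem (F.x_mem _) (F.x_mem _), by simp [F.σ_x]⟩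
    · refine mem_evenPart.2 ⟨F.u_mem i, ?_⟩
      simp only [S, Sum.elim_inl, Sum.elim_inr, F.σ_u]
      exact Int.dvd_of_emod_eq_zero (hβ i)
    · have := hγ k₀
      have := hγ k
      simp only [S, Sum.elim_inr]
      split_ifs
      · refine mem_evenPart.2 ⟨F.v_mem _, ?_⟩
        rw [F.σ_v]
        omega
      · refine mem_evenPart.2 ⟨N.sub_mem (F.v_mem _) (F.v_mem _), ?_⟩
        rw [map_sub, F.σ_v, F.σ_v]
        omega
  · have := hβ i
    omega
  · have := hγ k
    omega
  · by_cases ha : a = a₀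
    · simp [ha]
    · simpa [S, ha] using hS (.inl a)
  · by_cases hk : k = k₀
    · simpa [hk] using hS₀
    · simpa [S, hk] using Submodule.add_mem _ (hS (.inr (.inr k))) hS₀
  · rintro (a | i | k)
    · simp only [T, Sum.elim_inl]
      split_ifs
      · exact mem_evenPart.2 ⟨F.y_mem _, by simp [F.σ_y]⟩
      · exact mem_evenPart.2 ⟨N.sub_mem (F.y_mem _) (F.y_mem _), by simp [F.σ_y]⟩
    · exact mem_evenPart.2 ⟨N.sub_mem (F.r_mem i) (F.z_mem _), by simp [T, F.σ_r, F.σ_z]⟩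
    · simp only [T, Sum.elim_inr]
      split_ifs
      · exact mem_evenPart.2 ⟨N.smul_mem _ (F.z_mem _), by simp⟩
      · exact mem_evenPart.2 ⟨N.sub_mem (F.z_mem _) (F.z_mem _), by simp [F.σ_z]⟩
  · by_cases ha : a = a₀
    · rwa [ha]
    · simpa [T, ha] using Submodule.add_mem _ (hT (.inl a)) hT₀
  · by_cases hk : k = k₀
    · simp [hk]
    · simpa [T, hk] using hT (.inr (.inr k))
  · rintro (a | i | k)
    · simp only [S, T, Sum.elim_inl]
      split_ifs <;> simp [F.f_x]
    · simp [S, F.f_u]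
    · simp only [S, T, Sum.elim_inr]
      split_ifs <;> simp [F.f_v, smul_sub]

/-- All positive cycles of even length, and negative cycles of both parities: the pivot `v k₁` is
the sum over an odd negative cycle. Its interaction with an even one produces the factor `4`. -/
theorem isDiagonalizedBy_of_even_of_ne [DecidableEq Q] (F : CycleFamilies f σ N X β γ)
    (hβ : ∀ i, β i % 2 = 0) {k₀ k₁ : Q} (hk₀ : γ k₀ % 2 = 0) (hk₁ : γ k₁ % 2 = 1) :
    IsDiagonalizedBy f (evenPart σ N) (Sum.elim (fun _ : X => 1)
      (Sum.elim (fun _ : P => 0) fun k : Q => if k = k₀ then 1 else if k = k₁ then 4 else 2)) := by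
  have hne : k₁ ≠ k₀ := by
    rintro rfl
    omega
  let m (k : Q) : Q := if γ k % 2 = 0 then k₀ else k₁
  have hm (k : Q) : γ k % 2 = γ (m k) % 2 := by
    simp only [m]
    split_ifs <;> omega
  let S : X ⊕ P ⊕ Q → M := Sum.elim (fun a => F.x a - F.v k₁)
    (Sum.elim F.u fun k => if k = k₀ then F.v k₀ else
      if k = k₁ then (2 : ℤ) • F.v k₁ - (2 : ℤ) • F.v k₀ else F.v k - F.v (m k))
  let T : X ⊕ P ⊕ Q → M := Sum.elim (fun a => F.y a - (2 : ℤ) • F.z k₁)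
    (Sum.elim (fun i => F.r i - F.z k₁)
      fun k => if k = k₀ then (2 : ℤ) • F.z k₀ else
        if k = k₁ then F.z k₁ - F.z k₀ else F.z k - F.z (m k))
  have hS i : S i ∈ Submodule.span ℤ (Set.range S) := Submodule.subset_span ⟨i, rfl⟩
  have hT i : T i ∈ Submodule.span ℤ (Set.range T) := Submodule.subset_span ⟨i, rfl⟩
  have hS₀ : F.v k₀ ∈ Submodule.span ℤ (Set.range S) := by simpa [S] using hS (.inr (.inr k₀))
  have hS₁ : (2 : ℤ) • F.v k₁ ∈ Submodule.span ℤ (Set.range S) := by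
    simpa [S, hne] using
      Submodule.add_mem _ (hS (.inr (.inr k₁))) (Submodule.smul_mem _ (2 : ℤ) hS₀)
  have hT₀ : (2 : ℤ) • F.z k₀ ∈ Submodule.span ℤ (Set.range T) := by
    simpa [T] using hT (.inr (.inr k₀))
  have hT₁ : F.z k₁ - F.z k₀ ∈ Submodule.span ℤ (Set.range T) := by
    simpa [T, hne] using hT (.inr (.inr k₁))
  have hT₂ : (2 : ℤ) • F.z k₁ ∈ Submodule.span ℤ (Set.range T) := by
    convert Submodule.add_mem _ (Submodule.smul_mem _ (2 : ℤ) hT₁) hT₀ using 1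
    module
  refine ⟨S, T, F.span_eq_of_source ?_ (F.v k₁) (fun _ => 1) (fun _ => 0) (fun k => γ k % 2)
    (by simp) (fun i => ?_) (fun k => by omega) ⟨hS₁,
      fun a => by simpa [S] using hS (.inl a), fun i => by simpa [S] using hS (.inr (.inl i)),
      fun k => ?_⟩,
    F.span_eq_of_target ?_ (F.z k₁) ⟨hT₂, fun a => ?_, fun i => hT (.inr (.inl i)), fun k => ?_⟩,
    ?_⟩
  · rintro (a | i | k)
    · refine mem_evenPart.2 ⟨N.sub_mem (F.x_mem a) (F.v_mem _), ?_⟩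
      simp only [S, Sum.elim_inl, map_sub, F.σ_x, F.σ_v]
      omega
    · refine mem_evenPart.2 ⟨F.u_mem i, ?_⟩
      simp only [S, Sum.elim_inl, Sum.elim_inr, F.σ_u]
      exact Int.dvd_of_emod_eq_zero (hβ i)
    · simp only [S, Sum.elim_inr]
      split_ifs
      · refine mem_evenPart.2 ⟨F.v_mem _, ?_⟩
        rw [F.σ_v]
        omega
      · refine mem_evenPart.2
          ⟨N.sub_mem (N.smul_mem _ (F.v_mem _)) (N.smul_mem _ (F.v_mem _)), ?_⟩
        simp only [map_sub, map_smul, smul_eq_mul]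
        omega
      · refine mem_evenPart.2 ⟨N.sub_mem (F.v_mem _) (F.v_mem _), ?_⟩
        rw [map_sub, F.σ_v, F.σ_v]
        have := hm k
        omega
  · have := hβ i
    omega
  · by_cases h₀ : k = k₀
    · subst h₀
      simpa [hk₀] using hS₀
    by_cases h₁ : k = k₁
    · subst h₁
      simp [hk₁]
    have h : F.v k - F.v (m k) ∈ Submodule.span ℤ (Set.range S) := by
      convert hS (.inr (.inr k)) using 1
      simp [S, h₀, h₁]
    by_cases hk : γ k % 2 = 0
    · rw [show m k = k₀ from if_pos hk] at h
      rw [hk, zero_smul, sub_zero]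
      exact (Submodule.sub_mem_iff_left _ hS₀).1 h
    · rw [show m k = k₁ from if_neg hk] at h
      rwa [show γ k % 2 = 1 by omega, one_smul]
  · rintro (a | i | k)
    · exact mem_evenPart.2 ⟨N.sub_mem (F.y_mem a) (N.smul_mem _ (F.z_mem _)),
        by simp [T, F.σ_y]⟩
    · exact mem_evenPart.2 ⟨N.sub_mem (F.r_mem i) (F.z_mem _), by simp [T, F.σ_r, F.σ_z]⟩
    · simp only [T, Sum.elim_inr]
      split_ifs
      · exact mem_evenPart.2 ⟨N.smul_mem _ (F.z_mem _), by simp⟩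
      · exact mem_evenPart.2 ⟨N.sub_mem (F.z_mem _) (F.z_mem _), by simp [F.σ_z]⟩
      · exact mem_evenPart.2 ⟨N.sub_mem (F.z_mem _) (F.z_mem _), by simp [F.σ_z]⟩
  · simpa [T] using Submodule.add_mem _ (hT (.inl a)) hT₂
  · by_cases h₀ : k = k₀
    · subst h₀
      simpa using Submodule.neg_mem _ hT₁
    by_cases h₁ : k = k₁
    · simp [h₁]
    have h : F.z k - F.z (m k) ∈ Submodule.span ℤ (Set.range T) := by
      convert hT (.inr (.inr k)) using 1
      simp [T, h₀, h₁]
    by_cases hk : γ k % 2 = 0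
    · rw [show m k = k₀ from if_pos hk] at h
      simpa only [sub_sub_sub_cancel_right, sub_sub, add_sub_cancel] using Submodule.sub_mem _ h hT₁
    · rwa [show m k = k₁ from if_neg hk] at h
  · rintro (a | i | k)
    · simp [S, T, F.f_x, F.f_v]
    · simp [S, F.f_u]
    · simp only [S, T, Sum.elim_inr]
      split_ifs
      · simp [F.f_v]
      · simp only [map_sub, map_smul, F.f_v]
        module
      · simp [F.f_v, smul_sub]

/-- Only positive cycles, all of even length: the pivot is again a basis vector `x a₀`. -/
theorem isDiagonalizedBy_of_even_of_isEmpty [DecidableEq X] [DecidableEq P] [IsEmpty Q]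
    (F : CycleFamilies f σ N X β γ) (hβ : ∀ i, β i % 2 = 0) (a₀ : X) (i₀ : P) :
    IsDiagonalizedBy f (evenPart σ N) (Sum.elim (fun a : X => if a = a₀ then 2 else 1)
      (Sum.elim (fun _ : P => 0) fun _ : Q => 2)) := by
  let S : X ⊕ P ⊕ Q → M :=
    Sum.elim (fun a => if a = a₀ then (2 : ℤ) • F.x a₀ else F.x a - F.x a₀) (Sum.elim F.u F.v)
  let T : X ⊕ P ⊕ Q → M := Sum.elim (fun a => if a = a₀ then F.y a₀ else F.y a - F.y a₀)
    (Sum.elim (fun i => if i = i₀ then (2 : ℤ) • F.r i₀ else F.r i - F.r i₀) F.z)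
  have hS i : S i ∈ Submodule.span ℤ (Set.range S) := Submodule.subset_span ⟨i, rfl⟩
  have hT i : T i ∈ Submodule.span ℤ (Set.range T) := Submodule.subset_span ⟨i, rfl⟩
  have hT₀ : F.y a₀ ∈ Submodule.span ℤ (Set.range T) := by simpa [T] using hT (.inl a₀)
  refine ⟨S, T, F.span_eq_of_source ?_ (F.x a₀) (fun _ => 1) (fun _ => 0) (fun _ => 0) (by simp)
    (fun i => ?_) isEmptyElim ⟨by simpa [S] using hS (.inl a₀),
      fun a => ?_, fun i => by simpa [S] using hS (.inr (.inl i)), isEmptyElim⟩,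
    F.span_eq_of_target ?_ (F.r i₀) ⟨by simpa [T] using hT (.inr (.inl i₀)), fun a => ?_,
      fun i => ?_, isEmptyElim⟩, ?_⟩
  · rintro (a | i | k)
    · simp only [S, Sum.elim_inl]
      split_ifs
      · exact mem_evenPart.2 ⟨N.smul_mem _ (F.x_mem _), by simp⟩
      · exact mem_evenPart.2 ⟨N.sub_mem (F.x_mem _) (F.x_mem _), by simp [F.σ_x]⟩
    · refine mem_evenPart.2 ⟨F.u_mem i, ?_⟩
      simp only [S, Sum.elim_inl, Sum.elim_inr, F.σ_u]
      exact Int.dvd_of_emod_eq_zero (hβ i)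
    · exact isEmptyElim k
  · have := hβ i
    omega
  · by_cases ha : a = a₀
    · simp [ha]
    · simpa [S, ha] using hS (.inl a)
  · rintro (a | i | k)
    · simp only [T, Sum.elim_inl]
      split_ifs
      · exact mem_evenPart.2 ⟨F.y_mem _, by simp [F.σ_y]⟩
      · exact mem_evenPart.2 ⟨N.sub_mem (F.y_mem _) (F.y_mem _), by simp [F.σ_y]⟩
    · simp only [T, Sum.elim_inl, Sum.elim_inr]
      split_ifs
      · exact mem_evenPart.2 ⟨N.smul_mem _ (F.r_mem _), by simp⟩
      · exact mem_evenPart.2 ⟨N.sub_mem (F.r_mem _) (F.r_mem _), by simp [F.σ_r]⟩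
    · exact isEmptyElim k
  · by_cases ha : a = a₀
    · rwa [ha]
    · simpa [T, ha] using Submodule.add_mem _ (hT (.inl a)) hT₀
  · by_cases hi : i = i₀
    · simp [hi]
    · simpa [T, hi] using hT (.inr (.inl i))
  · rintro (a | i | k)
    · simp only [S, T, Sum.elim_inl]
      split_ifs <;> simp [F.f_x]
    · simp [S, F.f_u]
    · exact isEmptyElim k

end CycleFamilies

end CycleFamilies

/-! ### Adapted families from signed cycles -/

section Cycles

variable {M : Type*} [AddCommGroup M] {f : M →ₗ[ℤ] M} {σ : M →ₗ[ℤ] ℤ}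
  {P Q : Type*} {β : P → ℕ} {γ : Q → ℕ}

theorem map_sum_positive_cycle {e : ℕ → M} {b : ℕ}
    (h : ∀ i < b, f (e i) = e i - e (i + 1)) (hlast : f (e b) = e b - e 0) :
    f (∑ i ∈ Finset.range (b + 1), e i) = 0 := by
  rw [map_sum, Finset.sum_range_succ, hlast,
    Finset.sum_congr rfl fun i hi => h i (Finset.mem_range.1 hi), Finset.sum_range_sub']
  abel

theorem map_sum_negative_cycle {e : ℕ → M} {b : ℕ}
    (h : ∀ i < b, f (e i) = e i - e (i + 1)) (hlast : f (e b) = e b + e 0) :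
    f (∑ i ∈ Finset.range (b + 1), e i) = (2 : ℤ) • e 0 := by
  rw [map_sum, Finset.sum_range_succ, hlast,
    Finset.sum_congr rfl fun i hi => h i (Finset.mem_range.1 hi), Finset.sum_range_sub']
  module

theorem mem_of_sum_mem {e : ℕ → M} {b : ℕ} {K : Submodule ℤ M} (h : ∀ i < b, e i ∈ K)
    (hsum : ∑ i ∈ Finset.range (b + 1), e i ∈ K) {i : ℕ} (hi : i ≤ b) : e i ∈ K := by
  rcases hi.lt_or_eq with hi | rfl
  · exact h i hi
  · rw [Finset.sum_range_succ] at hsum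
    exact (Submodule.add_mem_iff_right _
      (Submodule.sum_mem _ fun i hi => h i (Finset.mem_range.1 hi))).1 hsum

/-- The adapted families of `f = 1 - w`, where `w` permutes the vectors `e k i` with `i ≤ β k`
in positive cycles and the vectors `g k i` with `i ≤ γ k` in negative cycles. -/
def CycleFamilies.ofCycles (e : P → ℕ → M) (g : Q → ℕ → M)
    (he : ∀ k, ∀ i < β k, f (e k i) = e k i - e k (i + 1))
    (he' : ∀ k, f (e k (β k)) = e k (β k) - e k 0)
    (hg : ∀ k, ∀ i < γ k, f (g k i) = g k i - g k (i + 1))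
    (hg' : ∀ k, f (g k (γ k)) = g k (γ k) + g k 0)
    (hσe : ∀ k, ∀ i ≤ β k, σ (e k i) = 1) (hσg : ∀ k, ∀ i ≤ γ k, σ (g k i) = 1) :
    CycleFamilies f σ (Submodule.span ℤ {v | (∃ k, ∃ i ≤ β k, e k i = v) ∨
      ∃ k, ∃ i ≤ γ k, g k i = v}) ((Σ k, Fin (β k)) ⊕ Σ k, Fin (γ k))
      (fun k => (β k + 1 : ℤ)) (fun k => (γ k + 1 : ℤ)) where
  x := Sum.elim (fun a => e a.1 a.2) fun a => g a.1 a.2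
  u k := ∑ i ∈ Finset.range (β k + 1), e k i
  v k := ∑ i ∈ Finset.range (γ k + 1), g k i
  y := Sum.elim (fun a => e a.1 a.2 - e a.1 (a.2 + 1)) fun a => g a.1 a.2 - g a.1 (a.2 + 1)
  r k := e k (β k)
  z k := g k 0
  f_x := by
    rintro (⟨k, i⟩ | ⟨k, i⟩)
    exacts [he k i i.2, hg k i i.2]
  f_u k := map_sum_positive_cycle (he k) (he' k)
  f_v k := map_sum_negative_cycle (hg k) (hg' k)
  σ_x := by
    rintro (⟨k, i⟩ | ⟨k, i⟩)
    exacts [hσe k i i.2.le, hσg k i i.2.le]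
  σ_u k := by
    rw [map_sum, Finset.sum_congr rfl fun i hi => hσe k i (Finset.mem_range_succ_iff.1 hi)]
    simp
  σ_v k := by
    rw [map_sum, Finset.sum_congr rfl fun i hi => hσg k i (Finset.mem_range_succ_iff.1 hi)]
    simp
  σ_y := by
    rintro (⟨k, i⟩ | ⟨k, i⟩)
    · simp [hσe k i i.2.le, hσe k (i + 1) i.2]
    · simp [hσg k i i.2.le, hσg k (i + 1) i.2]
  σ_r k := hσe k _ le_rfl
  σ_z k := hσg k 0 (Nat.zero_le _)
  span_source := by
    refine le_antisymm (Submodule.span_le.2 ?_) (Submodule.span_le.2 ?_)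
    · rintro _ ⟨(⟨k, i⟩ | ⟨k, i⟩) | k | k, rfl⟩ <;>
        simp only [SetLike.mem_coe, Sum.elim_inl, Sum.elim_inr]
      · exact Submodule.subset_span (.inl ⟨k, i, i.2.le, rfl⟩)
      · exact Submodule.subset_span (.inr ⟨k, i, i.2.le, rfl⟩)
      · refine Submodule.sum_mem _ fun i hi => Submodule.subset_span (Or.inl ?_)
        exact ⟨k, i, Finset.mem_range_succ_iff.1 hi, rfl⟩
      · refine Submodule.sum_mem _ fun i hi => Submodule.subset_span (Or.inr ?_)
        exact ⟨k, i, Finset.mem_range_succ_iff.1 hi, rfl⟩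
    · rintro _ (⟨k, i, hi, rfl⟩ | ⟨k, i, hi, rfl⟩) <;> rw [SetLike.mem_coe]
      · refine mem_of_sum_mem (e := e k) (fun i hi => Submodule.subset_span ?_)
          (Submodule.subset_span ?_) hi
        exacts [⟨.inl (.inl ⟨k, i, hi⟩), rfl⟩, ⟨.inr (.inl k), rfl⟩]
      · refine mem_of_sum_mem (e := g k) (fun i hi => Submodule.subset_span ?_)
          (Submodule.subset_span ?_) hi
        exacts [⟨.inl (.inr ⟨k, i, hi⟩), rfl⟩, ⟨.inr (.inr k), rfl⟩]
  span_target := by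
    refine le_antisymm (Submodule.span_le.2 ?_) (Submodule.span_le.2 ?_)
    · rintro _ ⟨(⟨k, i⟩ | ⟨k, i⟩) | k | k, rfl⟩ <;>
        simp only [SetLike.mem_coe, Sum.elim_inl, Sum.elim_inr]
      · exact Submodule.sub_mem _ (Submodule.subset_span (.inl ⟨k, i, i.2.le, rfl⟩))
          (Submodule.subset_span (.inl ⟨k, i + 1, i.2, rfl⟩))
      · exact Submodule.sub_mem _ (Submodule.subset_span (.inr ⟨k, i, i.2.le, rfl⟩))
          (Submodule.subset_span (.inr ⟨k, i + 1, i.2, rfl⟩))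
      · exact Submodule.subset_span (.inl ⟨k, _, le_rfl, rfl⟩)
      · exact Submodule.subset_span (.inr ⟨k, 0, Nat.zero_le _, rfl⟩)
    · rintro _ (⟨k, i, hi, rfl⟩ | ⟨k, i, hi, rfl⟩) <;> rw [SetLike.mem_coe]
      · induction hi using Nat.decreasingInduction with
        | self => exact Submodule.subset_span ⟨.inr (.inl k), rfl⟩
        | of_succ i hi ih =>
          exact (Submodule.sub_mem_iff_left _ ih).1
            (Submodule.subset_span ⟨.inl (.inl ⟨k, i, hi⟩), rfl⟩)
      · induction i with
        | zero => exact Submodule.subset_span ⟨.inr (.inr k), rfl⟩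
        | succ i ih =>
          exact (Submodule.sub_mem_iff_right _ (ih (by omega))).1
            (Submodule.subset_span ⟨.inl (.inr ⟨k, i, hi⟩), rfl⟩)

end Cycles

open scoped Matrix in
/-- Families that span `2 ℤⁿ` and diagonalize `f` halve to bases of `ℤⁿ` that diagonalize `f`. -/
theorem IsDiagonalizedBy.hasSmithNormalForm {n : ℕ} {ι : Type*} [Fintype ι]
    {f : (Fin n → ℤ) →ₗ[ℤ] Fin n → ℤ} {E : Submodule ℤ (Fin n → ℤ)} {D : ι → ℕ}
    (h : IsDiagonalizedBy f E D) (hE : ∀ v, v ∈ E ↔ ∃ v', v = (2 : ℤ) • v')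
    {d : List ℕ} (hlen : d.length = n) (hdvd : d.Pairwise (· ∣ ·))
    (hD : ∑ i, ({D i} : Multiset ℕ) = (d : Multiset ℕ)) :
    HasSmithNormalForm (LinearMap.toMatrix' f) d := by
  obtain ⟨S, T, hS, hT, hf⟩ := h
  have halve {S : ι → Fin n → ℤ} (hS : Submodule.span ℤ (Set.range S) = E) :
      ∃ S', (∀ i, S i = (2 : ℤ) • S' i) ∧ Submodule.span ℤ (Set.range S') = ⊤ := by
    choose S' hS' using fun i => (hE (S i)).1 (hS.le (Submodule.subset_span ⟨i, rfl⟩))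
    refine ⟨S', hS', eq_top_iff.2 fun v _ => ?_⟩
    have hv : (2 : ℤ) • v ∈ Submodule.span ℤ (Set.range S) := hS.ge ((hE _).2 ⟨v, rfl⟩)
    obtain ⟨c, hc⟩ := (Submodule.mem_span_range_iff_exists_fun ℤ).1 hv
    refine (Submodule.mem_span_range_iff_exists_fun ℤ).2 ⟨c, ?_⟩
    apply smul_right_injective _ (two_ne_zero (α := ℤ))
    simp only [Finset.smul_sum, ← hc, hS']
    exact Finset.sum_congr rfl fun i _ => smul_comm _ _ _
  obtain ⟨S', hS', hS⟩ := halve hS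
  obtain ⟨T', hT', hT⟩ := halve hT
  refine hasSmithNormalForm_of_span _ d hlen hdvd D hD S' T' hS hT fun i => ?_
  apply smul_right_injective _ (two_ne_zero (α := ℤ))
  simp only [LinearMap.toMatrix'_mulVec]
  rw [← map_smul, ← hS', hf, hT', smul_comm]

/-! ### The action of the Weyl group on coordinate vectors -/

namespace TypeB

/-- Twice the coordinate vector with index `k < n` of the standard realization
`α_k^∨ = e_k - e_{k+1}` for `k + 1 < n`, `α_{n-1}^∨ = 2 e_{n-1}`, as an element of the coroot
lattice. It is `0` for `k ≥ n`. -/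
def twiceCoord (n k : ℕ) : CorootLattice n :=
  fun j => if (j : ℕ) < k then 0 else if (j : ℕ) + 1 = n then 1 else 2

theorem twiceCoord_eq_add {n k : ℕ} (h : k + 1 < n) :
    twiceCoord n k = twiceCoord n (k + 1) + (2 : ℤ) • simpleCoroot n ⟨k, by omega⟩ := by
  ext j
  simp only [twiceCoord, simpleCoroot, Pi.add_apply, Pi.smul_apply, Pi.single_apply, Fin.ext_iff,
    smul_eq_mul]
  split_ifs <;> omega

theorem twiceCoord_last {n k : ℕ} (h : k + 1 = n) :
    twiceCoord n k = simpleCoroot n ⟨k, by omega⟩ := by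
  ext j
  have := j.2
  simp only [twiceCoord, simpleCoroot, Pi.single_apply, Fin.ext_iff]
  split_ifs <;> omega

theorem twiceCoord_of_le {n k : ℕ} (h : n ≤ k) : twiceCoord n k = 0 := by
  ext j
  have := j.2
  simp only [twiceCoord, Pi.zero_apply]
  split_ifs <;> omega

theorem simpleRoot_twiceCoord {n k : ℕ} (hk : k < n) (i : Fin n) :
    simpleRoot n i (twiceCoord n k) =
      2 * ((if (i : ℕ) = k then 1 else 0) - if (i : ℕ) + 1 = k then 1 else 0) := by
  obtain ⟨i, hi⟩ := i
  have hk' : k ≤ n - 1 := by omega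
  induction hk' using Nat.decreasingInduction with
  | self =>
    rw [twiceCoord_last (by omega), simpleRoot_simpleCoroot]
    simp only [CartanMatrix.B, Matrix.of_apply, Fin.ext_iff]
    split_ifs <;> omega
  | of_succ k hk' ih =>
    rw [twiceCoord_eq_add (by omega), map_add, map_smul, ih (by omega), simpleRoot_simpleCoroot]
    simp only [CartanMatrix.B, Matrix.of_apply, Fin.ext_iff, smul_eq_mul]
    split_ifs <;> omega

theorem s_smul {n i : ℕ} (hi : i < n) (v : CorootLattice n) :
    s n (i + 1) • v = v - simpleRoot n ⟨i, hi⟩ v • simpleCoroot n ⟨i, hi⟩ := by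
  have h : 1 ≤ i + 1 ∧ i + 1 ≤ n := by omega
  rw [s, dif_pos h, Subgroup.smul_def]
  exact Module.reflection_apply v (simpleRoot_simpleCoroot_self n ⟨i, hi⟩)

theorem s_smul_twiceCoord {n i : ℕ} (hi : i + 1 < n) (k : ℕ) :
    s n (i + 1) • twiceCoord n k = twiceCoord n (Equiv.swap i (i + 1) k) := by
  rcases le_or_gt n k with hk | hk
  · rw [Equiv.swap_apply_of_ne_of_ne (by omega) (by omega), twiceCoord_of_le hk, smul_zero]
  rw [s_smul (by omega), simpleRoot_twiceCoord hk]
  rcases eq_or_ne k i with rfl | h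
  · rw [Equiv.swap_apply_left, twiceCoord_eq_add hi]
    simp
  rcases eq_or_ne k (i + 1) with rfl | h'
  · rw [Equiv.swap_apply_right, twiceCoord_eq_add hi]
    simp
  · rw [Equiv.swap_apply_of_ne_of_ne h h']
    simp [h.symm, h'.symm]

theorem s_last_smul_twiceCoord {n : ℕ} (hn : 1 ≤ n) (k : ℕ) :
    s n n • twiceCoord n k = if k + 1 = n then -twiceCoord n k else twiceCoord n k := by
  obtain ⟨n, rfl⟩ := Nat.exists_eq_add_of_le' hn
  rcases le_or_gt (n + 1) k with hk | hk
  · rw [if_neg (by omega), twiceCoord_of_le hk, smul_zero]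
  rw [s_smul (by omega), simpleRoot_twiceCoord hk]
  rcases eq_or_ne k n with rfl | h
  · rw [twiceCoord_last rfl]
    simp only [if_true, if_neg (Nat.succ_ne_self k)]
    module
  · have : n + 1 ≠ k := by omega
    simp [h, h.symm, this]

/-- A positive block acts as a cyclic permutation. -/
theorem positiveBlock_smul_twiceCoord {n j b : ℕ} (h : j + b < n) (k : ℕ) :
    positiveBlock n j (b + 1) • twiceCoord n k =
      twiceCoord n (if j ≤ k ∧ k < j + b then k + 1 else if k = j + b then j else k) := by
  induction b generalizing k with
  | zero =>
    simp only [positiveBlock, zero_add, Nat.sub_self, List.ofFn_zero, List.prod_nil, one_smul]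
    congr 1
    split_ifs <;> omega
  | succ b ih =>
    have hmul : positiveBlock n j (b + 1 + 1) = positiveBlock n j (b + 1) * s n (j + b + 1) := by
      simp only [positiveBlock, Nat.add_sub_cancel]
      rw [List.ofFn_succ']
      simp [add_right_comm]
    rw [hmul, mul_smul, s_smul_twiceCoord (by omega), ih (by omega)]
    congr 1
    simp only [Equiv.swap_apply_def]
    split_ifs <;> omega

/-- The element `t_j` changes the sign of the `(n - j)`-th coordinate. -/
theorem t_smul_twiceCoord {n j : ℕ} (h : j < n) (k : ℕ) :
    t n j • twiceCoord n k = if k + j + 1 = n then -twiceCoord n k else twiceCoord n k := by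
  induction j generalizing k with
  | zero => exact s_last_smul_twiceCoord h k
  | succ j ih =>
    have hs : n - (j + 1) = n - (j + 2) + 1 := by omega
    rw [t, hs, mul_smul, mul_smul, s_smul_twiceCoord (by omega), ih (by omega)]
    simp only [apply_ite (fun v => s n (n - (j + 2) + 1) • v), smul_neg]
    rw [s_smul_twiceCoord (by omega), Equiv.swap_apply_self]
    congr 1
    simp only [Equiv.swap_apply_def]
    split_ifs <;> simp <;> omega

/-- A negative block acts as a cyclic permutation followed by one change of sign. -/
theorem negativeBlock_smul_twiceCoord {n j c : ℕ} (h : j + c < n) (k : ℕ) :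
    negativeBlock n j (c + 1) • twiceCoord n k =
      if k + j + c + 1 = n then -twiceCoord n (n - 1 - j) else
        twiceCoord n (if n < k + j + c + 1 ∧ k + j + 1 ≤ n then k - 1 else k) := by
  induction c generalizing k with
  | zero =>
    simp only [negativeBlock, zero_add, Nat.sub_self, List.ofFn_zero, List.prod_nil, mul_one]
    rw [t_smul_twiceCoord (by omega)]
    split_ifs
    · congr 2
      omega
    · omega
    · rfl
  | succ c ih =>
    have hmul : negativeBlock n j (c + 1 + 1) =
        negativeBlock n j (c + 1) * s n (n - (j + c + 2) + 1) := by
      have hi : n - (j + c + 2) + 1 = n - (j + 1 + c) := by omega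
      simp only [negativeBlock, Nat.add_sub_cancel]
      rw [List.ofFn_succ', hi]
      simp [mul_assoc]
    rw [hmul, mul_smul, s_smul_twiceCoord (by omega), ih (by omega)]
    simp only [Equiv.swap_apply_def]
    split_ifs <;> first | rfl | omega | (congr 1; omega)

theorem list_prod_smul_of_fixed {G V : Type*} [Monoid G] [MulAction G V] {l : List G} {v : V}
    (h : ∀ g ∈ l, g • v = v) : l.prod • v = v := by
  induction l with
  | nil => simp
  | cons g l ih =>
    rw [List.prod_cons, mul_smul, ih fun g hg => h g (List.mem_cons_of_mem _ hg),
      h g List.mem_cons_self]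

theorem prod_ofFn_smul {G V : Type*} [Monoid G] [MulAction G V] {p : ℕ} {g : Fin p → G} (k : Fin p)
    {v v' : V} (h : g k • v = v') (hv : ∀ l, k < l → g l • v = v)
    (hv' : ∀ l, l < k → g l • v' = v') : (List.ofFn g).prod • v = v' := by
  induction p with
  | zero => exact k.elim0
  | succ p ih =>
    rw [List.ofFn_succ, List.prod_cons, mul_smul]
    cases k using Fin.cases with
    | zero =>
      rw [list_prod_smul_of_fixed, h]
      intro x hx
      obtain ⟨l, rfl⟩ := List.mem_ofFn.1 hx
      exact hv _ (Fin.succ_pos l)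
    | succ k =>
      rw [ih k h (fun l hl => hv _ (Fin.succ_lt_succ_iff.2 hl))
        (fun l hl => hv' _ (Fin.succ_lt_succ_iff.2 hl)), hv' 0 (Fin.succ_pos k)]

theorem partialSum_add_le {r : ℕ} (a : Fin r → ℕ) {k l : Fin r} (h : k < l) :
    partialSum a k + a k ≤ partialSum a l := by
  rw [partialSum, partialSum, add_comm, ← Finset.sum_insert (by simp)]
  refine Finset.sum_le_sum_of_subset fun i hi => ?_
  simp only [Finset.mem_insert, Finset.mem_filter, Finset.mem_univ, true_and] at hi ⊢
  rcases hi with rfl | hi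
  exacts [h, hi.trans h]

theorem partialSum_add_le_sum {r : ℕ} (a : Fin r → ℕ) (k : Fin r) :
    partialSum a k + a k ≤ ∑ i, a i := by
  rw [partialSum, add_comm, ← Finset.sum_insert (by simp)]
  exact Finset.sum_le_sum_of_subset (Finset.subset_univ _)

theorem exists_eq_partialSum_add {r : ℕ} (a : Fin r → ℕ) {m : ℕ} (h : m < ∑ i, a i) :
    ∃ k, ∃ i < a k, m = partialSum a k + i := by
  obtain ⟨⟨k, i⟩, hki⟩ := finSigmaFinEquiv.surjective (⟨m, h⟩ : Fin (∑ i, a i))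
  refine ⟨k, i, i.2, ?_⟩
  have h' := congrArg Fin.val hki
  rw [finSigmaFinEquiv_apply] at h'
  change _ = m at h'
  rw [partialSum, ← h']
  congr 1
  refine Finset.sum_bij (fun l _ => Fin.castLE k.2.le l) (fun l _ => ?_)
    (fun l _ l' _ hl => Fin.castLE_injective _ hl) (fun l hl => ⟨⟨l, ?_⟩, Finset.mem_univ _, rfl⟩)
    fun l _ => rfl
  · simp only [Finset.mem_filter, Finset.mem_univ, true_and]
    exact l.2
  · simpa using hl

end TypeB

/-! ### The signed cycles of `w_{β,γ}` -/

namespace TypeB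

variable {n p q : ℕ} {β : Fin p → ℕ} {γ : Fin q → ℕ}

theorem wBeta_smul_twiceCoord (hβ : ∀ k, 1 ≤ β k) (hn : ∑ k, β k ≤ n) (k : Fin p) {i : ℕ}
    (hi : i < β k) :
    wBeta n β • twiceCoord n (partialSum β k + i) =
      twiceCoord n (partialSum β k + if i + 1 = β k then 0 else i + 1) := by
  have block (l : Fin p) (m : ℕ) : positiveBlock n (partialSum β l) (β l) • twiceCoord n m =
      twiceCoord n (if partialSum β l ≤ m ∧ m + 1 < partialSum β l + β l then m + 1
        else if m + 1 = partialSum β l + β l then partialSum β l else m) := by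
    obtain ⟨b, hb⟩ := Nat.exists_eq_add_of_le' (hβ l)
    have := partialSum_add_le_sum β l
    rw [hb, positiveBlock_smul_twiceCoord (by omega)]
    congr 1
    split_ifs <;> omega
  refine prod_ofFn_smul k ?_ (fun l hl => ?_) (fun l hl => ?_) <;> rw [block] <;> congr 1
  · split_ifs <;> omega
  · have := partialSum_add_le β hl
    have := hβ l
    split_ifs <;> omega
  · have := partialSum_add_le β hl
    split_ifs <;> omega

theorem wBeta_smul_twiceCoord_of_le (hβ : ∀ k, 1 ≤ β k) (hn : ∑ k, β k ≤ n) {m : ℕ}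
    (hm : ∑ k, β k ≤ m) : wBeta n β • twiceCoord n m = twiceCoord n m := by
  refine list_prod_smul_of_fixed fun x hx => ?_
  obtain ⟨l, rfl⟩ := List.mem_ofFn.1 hx
  obtain ⟨b, hb⟩ := Nat.exists_eq_add_of_le' (hβ l)
  have := partialSum_add_le_sum β l
  rw [hb, positiveBlock_smul_twiceCoord (by omega)]
  congr 1
  split_ifs <;> omega

theorem negativeBlock_smul_twiceCoord_of_outside (hγ : ∀ k, 1 ≤ γ k) (hn : ∑ k, γ k ≤ n)
    (l : Fin q) {m : ℕ}
    (hm : m + partialSum γ l + γ l < n ∨ n < m + partialSum γ l + 1) :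
    negativeBlock n (partialSum γ l) (γ l) • twiceCoord n m = twiceCoord n m := by
  obtain ⟨c, hc⟩ := Nat.exists_eq_add_of_le' (hγ l)
  have := partialSum_add_le_sum γ l
  rw [hc, negativeBlock_smul_twiceCoord (by omega), if_neg (by omega), if_neg (by omega)]

theorem wGamma_smul_twiceCoord (hγ : ∀ k, 1 ≤ γ k) (hn : ∑ k, γ k ≤ n) (k : Fin q) {i : ℕ}
    (hi : i < γ k) :
    wGamma n γ • twiceCoord n (n - 1 - (partialSum γ k + i)) =
      if i + 1 = γ k then -twiceCoord n (n - 1 - partialSum γ k)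
        else twiceCoord n (n - 1 - (partialSum γ k + (i + 1))) := by
  have hk := partialSum_add_le_sum γ k
  refine prod_ofFn_smul k ?_ (fun l hl => ?_) (fun l hl => ?_)
  · obtain ⟨c, hc⟩ := Nat.exists_eq_add_of_le' (hγ k)
    rw [hc, negativeBlock_smul_twiceCoord (by omega)]
    split_ifs <;> first | rfl | omega
  · have := partialSum_add_le γ hl
    exact negativeBlock_smul_twiceCoord_of_outside hγ hn l (by omega)
  · have := partialSum_add_le γ hl
    split_ifs
    · rw [smul_neg, negativeBlock_smul_twiceCoord_of_outside hγ hn l (by omega)]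
    · exact negativeBlock_smul_twiceCoord_of_outside hγ hn l (by omega)

theorem wGamma_smul_twiceCoord_of_lt (hγ : ∀ k, 1 ≤ γ k) {m : ℕ} (hm : m + ∑ k, γ k < n) :
    wGamma n γ • twiceCoord n m = twiceCoord n m := by
  refine list_prod_smul_of_fixed fun x hx => ?_
  obtain ⟨l, rfl⟩ := List.mem_ofFn.1 hx
  have := partialSum_add_le_sum γ l
  exact negativeBlock_smul_twiceCoord_of_outside hγ (by omega) l (by omega)

theorem wRep_smul_positive (hβ : ∀ k, 1 ≤ β k) (hγ : ∀ k, 1 ≤ γ k)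
    (hsum : (∑ k, β k) + (∑ k, γ k) = n) (k : Fin p) {i : ℕ} (hi : i < β k) :
    wRep n β γ • twiceCoord n (partialSum β k + i) =
      twiceCoord n (partialSum β k + if i + 1 = β k then 0 else i + 1) := by
  have := partialSum_add_le_sum β k
  rw [wRep, mul_smul, wGamma_smul_twiceCoord_of_lt hγ (by omega),
    wBeta_smul_twiceCoord hβ (by omega) k hi]

theorem wRep_smul_negative (hβ : ∀ k, 1 ≤ β k) (hγ : ∀ k, 1 ≤ γ k)
    (hsum : (∑ k, β k) + (∑ k, γ k) = n) (k : Fin q) {i : ℕ} (hi : i < γ k) :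
    wRep n β γ • twiceCoord n (n - 1 - (partialSum γ k + i)) =
      if i + 1 = γ k then -twiceCoord n (n - 1 - partialSum γ k)
        else twiceCoord n (n - 1 - (partialSum γ k + (i + 1))) := by
  have := partialSum_add_le_sum γ k
  rw [wRep, mul_smul, wGamma_smul_twiceCoord hγ (by omega) k hi]
  split_ifs
  · rw [smul_neg, wBeta_smul_twiceCoord_of_le hβ (by omega) (by omega)]
  · rw [wBeta_smul_twiceCoord_of_le hβ (by omega) (by omega)]

/-! ### The coroot lattice as an even sublattice -/

/-- The sum of the coordinates in the standard realization, normalized to take the value `1` on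
the vectors `twiceCoord n k`, is the coordinate at the last simple coroot. -/
def coordSum (hn : 0 < n) : CorootLattice n →ₗ[ℤ] ℤ := LinearMap.proj ⟨n - 1, by omega⟩

theorem coordSum_twiceCoord (hn : 0 < n) {k : ℕ} (hk : k < n) :
    coordSum hn (twiceCoord n k) = 1 := by
  simp only [coordSum, LinearMap.proj_apply, twiceCoord]
  split_ifs <;> omega

/-- The coroot lattice consists of the vectors with even coordinate sum in the standard
realization. -/
theorem mem_evenPart_span_twiceCoord (hn : 0 < n) (v : CorootLattice n) :
    v ∈ evenPart (coordSum hn)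
        (Submodule.span ℤ (Set.range fun k : Fin n => twiceCoord n k)) ↔
      ∃ v', v = (2 : ℤ) • v' := by
  constructor
  · intro hv
    have hle : evenPart (coordSum hn)
        (Submodule.span ℤ (Set.range fun k : Fin n => twiceCoord n k)) ≤
        LinearMap.range ((2 : ℤ) • (LinearMap.id : CorootLattice n →ₗ[ℤ] CorootLattice n)) := by
      refine evenPart_le le_rfl (twiceCoord n (n - 1)) ⟨_, rfl⟩ (fun _ => 1) (fun k => ?_)
        fun k => ⟨fun j => if (j : ℕ) < k then 0 else if (j : ℕ) + 1 = n then 0 else 1, ?_⟩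
      · rw [coordSum_twiceCoord hn k.2]
        simp
      · ext j
        have := j.2
        have := k.2
        simp only [LinearMap.smul_apply, LinearMap.id_apply, Pi.smul_apply, smul_eq_mul,
          one_smul, Pi.sub_apply, twiceCoord]
        split_ifs <;> omega
    obtain ⟨v', rfl⟩ := hle hv
    exact ⟨v', rfl⟩
  · rintro ⟨v, rfl⟩
    have hmem {k : ℕ} (hk : k < n) :
        twiceCoord n k ∈ Submodule.span ℤ (Set.range fun k : Fin n => twiceCoord n k) :=
      Submodule.subset_span ⟨⟨k, hk⟩, rfl⟩
    have hv : v = ∑ j, v j • simpleCoroot n j := by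
      ext i
      simp [simpleCoroot, Pi.single_apply]
    rw [hv, Finset.smul_sum]
    refine Submodule.sum_mem _ fun j _ => ?_
    rw [smul_comm]
    refine Submodule.smul_mem _ _ ?_
    by_cases hj : (j : ℕ) + 1 = n
    · rw [show simpleCoroot n j = twiceCoord n j from (twiceCoord_last hj).symm]
      exact mem_evenPart.2 ⟨Submodule.smul_mem _ _ (hmem j.2), by
        rw [map_smul]
        exact dvd_mul_right _ _⟩
    · have hj' : (j : ℕ) + 1 < n := by omega
      rw [show (2 : ℤ) • simpleCoroot n j = twiceCoord n j - twiceCoord n (j + 1) by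
        rw [twiceCoord_eq_add hj', add_sub_cancel_left]]
      refine mem_evenPart.2 ⟨Submodule.sub_mem _ (hmem j.2) (hmem hj'), ?_⟩
      rw [map_sub, coordSum_twiceCoord hn j.2, coordSum_twiceCoord hn hj', sub_self]
      exact dvd_zero _

/-! ### Diagonalizing `1 - w_{β,γ}` -/

/-- The endomorphism `1 - w` of the coroot lattice. -/
def idSub (w : weylGroup n) : CorootLattice n →ₗ[ℤ] CorootLattice n :=
  LinearMap.id - (w : CorootLattice n ≃ₗ[ℤ] CorootLattice n).toLinearMap

theorem idSub_apply (w : weylGroup n) (v : CorootLattice n) : idSub w v = v - w • v := rfl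

/-- The indices of the basis vectors that are not last in their cycle. -/
abbrev NonLast (β : Fin p → ℕ) (γ : Fin q → ℕ) : Type :=
  (Σ k, Fin (β k - 1)) ⊕ Σ k, Fin (γ k - 1)

theorem card_nonLast (hβ : ∀ k, 1 ≤ β k) (hγ : ∀ k, 1 ≤ γ k)
    (hsum : (∑ k, β k) + (∑ k, γ k) = n) : Fintype.card (NonLast β γ) + p + q = n := by
  have aux {r : ℕ} {a : Fin r → ℕ} (ha : ∀ k, 1 ≤ a k) : ∑ k, (a k - 1) + r = ∑ k, a k := by
    calc ∑ k, (a k - 1) + r = ∑ k, (a k - 1 + 1) := by simp [Finset.sum_add_distrib]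
      _ = ∑ k, a k := Finset.sum_congr rfl fun k _ => Nat.sub_add_cancel (ha k)
  have := aux hβ
  have := aux hγ
  simp only [NonLast, Fintype.card_sum, Fintype.card_sigma, Fintype.card_fin]
  omega

/-- The vectors `twiceCoord n k`, grouped along the cycles of `w_{β,γ}`, yield adapted families for
`1 - w_{β,γ}`. The negative cycles run through the coordinates from the last one downwards. -/
theorem nonempty_cycleFamilies (hn : 0 < n) (hβ : ∀ k, 1 ≤ β k) (hγ : ∀ k, 1 ≤ γ k)
    (hsum : (∑ k, β k) + (∑ k, γ k) = n) :
    Nonempty (CycleFamilies (idSub (wRep n β γ)) (coordSum hn)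
      (Submodule.span ℤ (Set.range fun k : Fin n => twiceCoord n k)) (NonLast β γ)
      (fun k => (β k : ℤ)) fun k => (γ k : ℤ)) := by
  have hb k := partialSum_add_le_sum β k
  have hc k := partialSum_add_le_sum γ k
  have F := CycleFamilies.ofCycles (f := idSub (wRep n β γ)) (σ := coordSum hn)
    (β := fun k => β k - 1) (γ := fun k => γ k - 1)
    (fun k i => twiceCoord n (partialSum β k + i))
    (fun k i => twiceCoord n (n - 1 - (partialSum γ k + i)))
    (fun k i hi => by
      rw [idSub_apply, wRep_smul_positive hβ hγ hsum k (by omega), if_neg (by omega)])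
    (fun k => by
      have := hβ k
      rw [idSub_apply, wRep_smul_positive hβ hγ hsum k (by omega), if_pos (by omega)])
    (fun k i hi => by
      rw [idSub_apply, wRep_smul_negative hβ hγ hsum k (by omega), if_neg (by omega)])
    (fun k => by
      have := hγ k
      rw [idSub_apply, wRep_smul_negative hβ hγ hsum k (by omega), if_pos (by omega),
        sub_neg_eq_add, add_zero])
    (fun k i hi => coordSum_twiceCoord hn (by have := hb k; have := hβ k; omega))
    (fun k i hi => coordSum_twiceCoord hn (by omega))
  have hset : {v | (∃ k, ∃ i ≤ β k - 1, twiceCoord n (partialSum β k + i) = v) ∨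
      ∃ k, ∃ i ≤ γ k - 1, twiceCoord n (n - 1 - (partialSum γ k + i)) = v} =
      Set.range fun k : Fin n => twiceCoord n k := by
    ext v
    constructor
    · rintro (⟨k, i, hi, rfl⟩ | ⟨k, i, hi, rfl⟩)
      · have := hb k
        have := hβ k
        exact ⟨⟨partialSum β k + i, by omega⟩, rfl⟩
      · exact ⟨⟨n - 1 - (partialSum γ k + i), by omega⟩, rfl⟩
    · rintro ⟨⟨m, hm⟩, rfl⟩
      by_cases hmβ : m < ∑ k, β k
      · obtain ⟨k, i, hi, rfl⟩ := exists_eq_partialSum_add β hmβ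
        exact Or.inl ⟨k, i, by omega, rfl⟩
      · obtain ⟨k, i, hi, h⟩ := exists_eq_partialSum_add γ (m := n - 1 - m) (by omega)
        exact Or.inr ⟨k, i, by omega, by
          change _ = twiceCoord n m
          rw [← h]
          congr 1
          omega⟩
  rw [hset] at F
  have hβ' : (fun k => ((β k - 1 : ℕ) : ℤ) + 1) = fun k => (β k : ℤ) := by
    funext k
    have := hβ k
    omega
  have hγ' : (fun k => ((γ k - 1 : ℕ) : ℤ) + 1) = fun k => (γ k : ℤ) := by
    funext k
    have := hγ k
    omega
  rw [hβ', hγ'] at F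
  exact ⟨F⟩

/-- A diagonalization of `1 - w_{β,γ}` on the even part, with the `p` coefficients of the positive
cycles equal to `0`, gives the Smith normal form on the coroot lattice. -/
theorem hasSmithNormalForm_wRep (hn : 0 < n) (hβ : ∀ k, 1 ≤ β k) (hγ : ∀ k, 1 ≤ γ k)
    (hsum : (∑ k, β k) + (∑ k, γ k) = n) {D₁ : NonLast β γ → ℕ} {D₃ : Fin q → ℕ}
    (h : CycleFamilies (idSub (wRep n β γ)) (coordSum hn)
      (Submodule.span ℤ (Set.range fun k : Fin n => twiceCoord n k)) (NonLast β γ)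
      (fun k => (β k : ℤ)) (fun k => (γ k : ℤ)) →
      IsDiagonalizedBy (idSub (wRep n β γ)) (evenPart (coordSum hn)
        (Submodule.span ℤ (Set.range fun k : Fin n => twiceCoord n k)))
        (Sum.elim D₁ (Sum.elim (fun _ : Fin p => 0) D₃)))
    {d : List ℕ} (hdvd : (d ++ List.replicate p 0).Pairwise (· ∣ ·))
    (hD : ∑ a, ({D₁ a} : Multiset ℕ) + ∑ k, ({D₃ k} : Multiset ℕ) = (d : Multiset ℕ)) :
    HasSmithNormalForm (idSubMatrix (wRep n β γ)) (d ++ List.replicate p 0) := by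
  obtain ⟨F⟩ := nonempty_cycleFamilies hn hβ hγ hsum
  have hsum' : ∑ i, ({Sum.elim D₁ (Sum.elim (fun _ : Fin p => 0) D₃) i} : Multiset ℕ) =
      ((d ++ List.replicate p 0 : List ℕ) : Multiset ℕ) := by
    rw [← Multiset.coe_add, ← hD, Multiset.coe_replicate, ← Multiset.nsmul_singleton]
    simp only [Fintype.sum_sum_type, Sum.elim_inl, Sum.elim_inr, Finset.sum_const,
      Finset.card_univ, Fintype.card_fin]
    abel
  refine (h F).hasSmithNormalForm (mem_evenPart_span_twiceCoord hn) ?_ hdvd hsum'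
  have hcard := congrArg Multiset.card hsum'
  rw [Multiset.coe_card] at hcard
  have hX := card_nonLast hβ hγ hsum
  rw [← hcard]
  simp only [Multiset.card_sum, Multiset.card_singleton, Finset.sum_const, Finset.card_univ,
    Fintype.card_sum, Fintype.card_fin, smul_eq_mul, mul_one] at hX ⊢
  omega

/-! ### Counting diagonal entries and parities of the parts -/

theorem sum_singleton_ite {ι : Type*} [Fintype ι] [DecidableEq ι] (i₀ : ι) (a b : ℕ) :
    ∑ i, ({if i = i₀ then a else b} : Multiset ℕ) =
      {a} + Multiset.replicate (Fintype.card ι - 1) b := by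
  rw [← Finset.add_sum_erase _ _ (Finset.mem_univ i₀), if_pos rfl,
    Finset.sum_congr rfl fun i hi => by rw [if_neg (Finset.ne_of_mem_erase hi)], Finset.sum_const,
    Finset.card_erase_of_mem (Finset.mem_univ _), Finset.card_univ, Multiset.nsmul_singleton]

theorem sum_singleton_ite_ite {ι : Type*} [Fintype ι] [DecidableEq ι] {i₀ i₁ : ι} (h : i₁ ≠ i₀)
    (a b c : ℕ) :
    ∑ i, ({if i = i₀ then a else if i = i₁ then b else c} : Multiset ℕ) =
      {a} + ({b} + Multiset.replicate (Fintype.card ι - 2) c) := by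
  have h₁ : i₁ ∈ Finset.univ.erase i₀ := Finset.mem_erase.2 ⟨h, Finset.mem_univ _⟩
  rw [← Finset.add_sum_erase _ _ (Finset.mem_univ i₀), if_pos rfl, ← Finset.add_sum_erase _ _ h₁,
    if_neg h, if_pos rfl, Finset.sum_congr rfl fun i hi => by
      rw [if_neg (Finset.ne_of_mem_erase (Finset.mem_of_mem_erase hi)),
        if_neg (Finset.ne_of_mem_erase hi)],
    Finset.sum_const, Finset.card_erase_of_mem h₁, Finset.card_erase_of_mem (Finset.mem_univ _),
    Finset.card_univ, Multiset.nsmul_singleton, Nat.sub_sub]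

theorem gcdParts_gcd_two_eq_two (h : Nat.gcd (gcdParts β) 2 = 2) (k : Fin p) :
    (β k : ℤ) % 2 = 0 := by
  have h1 : 2 ∣ gcdParts β := Nat.gcd_eq_right_iff_dvd.1 h
  have h2 : 2 ∣ β k := h1.trans (Finset.gcd_dvd (Finset.mem_univ k))
  omega

theorem exists_odd_of_not_dvd_gcdParts (h : ¬ 2 ∣ gcdParts β) : ∃ k, (β k : ℤ) % 2 = 1 := by
  by_contra! hk
  refine h (Finset.dvd_gcd fun k _ => ?_)
  have := hk k
  omega

end TypeB

open TypeB List in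
theorem theorem6p1 (n : ℕ) (hn : 2 ≤ n) (p q : ℕ) (β : Fin p → ℕ) (γ : Fin q → ℕ)
    (hβ : Antitone β) (hγ : Monotone γ) (hβpos : ∀ k, 1 ≤ β k) (hγpos : ∀ k, 1 ≤ γ k)
    (hsum : (∑ k, β k) + (∑ k, γ k) = n) :
    (Nat.gcd (gcdParts β) 2 = 2 → 1 ≤ ∑ k, γ k → (∀ i j, γ i % 2 = γ j % 2) →
      HasSmithNormalForm (idSubMatrix (wRep n β γ))
        (replicate (n - q - p) 1 ++ replicate q 2 ++ replicate p 0)) ∧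
    (Nat.gcd (gcdParts β) 2 = 2 → 1 ≤ ∑ k, γ k → (∃ i j, γ i % 2 ≠ γ j % 2) →
      HasSmithNormalForm (idSubMatrix (wRep n β γ))
        (replicate (n - q - p + 1) 1 ++ replicate (q - 2) 2 ++ [4] ++ replicate p 0)) ∧
    (Nat.gcd (gcdParts β) 2 = 1 → 1 ≤ ∑ k, γ k →
      HasSmithNormalForm (idSubMatrix (wRep n β γ))
        (replicate (n - q - p + 1) 1 ++ replicate (q - 1) 2 ++ replicate p 0)) ∧
    (∑ k, γ k = 0 → 2 ≤ lastPart β → 2 ≤ Nat.gcd (gcdParts β) (lastPart β - 2) →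
      HasSmithNormalForm (idSubMatrix (wRep n β γ))
        (replicate (n - p - 1) 1 ++ [Nat.gcd (gcdParts β) (lastPart β - 2)] ++
          replicate p 0)) ∧
    (∑ k, γ k = 0 →
      (lastPart β = 1 ∨ (2 ≤ lastPart β ∧ Nat.gcd (gcdParts β) (lastPart β - 2) = 1)) →
      HasSmithNormalForm (idSubMatrix (wRep n β γ))
        (replicate (n - p) 1 ++ replicate p 0)) := by
  have hn₀ : 0 < n := by omega
  have hX := card_nonLast hβpos hγpos hsum
  have hq (h : 1 ≤ ∑ k, γ k) : Nonempty (Fin q) := by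
    by_contra hempty
    rw [not_nonempty_iff] at hempty
    simp at h
  have hq' (h : ∑ k, γ k = 0) : q = 0 := by
    by_contra hne
    have h0 := (Finset.sum_eq_zero_iff.1 h) ⟨0, by omega⟩ (Finset.mem_univ _)
    have := hγpos ⟨0, by omega⟩
    omega
  have hlast (h : 1 ≤ lastPart β) : ∃ k, lastPart β = β k := by
    cases p with
    | zero => simp [lastPart] at h
    | succ p => exact ⟨Fin.last p, rfl⟩
  refine ⟨fun h1 h2 h3 => ?_, fun h1 h2 h3 => ?_, fun h1 h2 => ?_, fun h1 h2 h3 => ?_,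
    fun h1 h2 => ?_⟩
  · obtain ⟨k₀⟩ := hq h2
    have hβe := gcdParts_gcd_two_eq_two h1
    have hdvd : (replicate (n - q - p) 1 ++ replicate q 2 ++ replicate p 0).Pairwise (· ∣ ·) := by
      simp [pairwise_append, pairwise_replicate, mem_replicate]
    rcases Nat.mod_two_eq_zero_or_one (γ k₀) with hk₀ | hk₀
    · have hγe k : (γ k : ℤ) % 2 = 0 := by
        have := h3 k k₀
        omega
      have hk₀' : 0 < γ k₀ - 1 := by
        have := hγpos k₀
        omega
      refine hasSmithNormalForm_wRep hn₀ hβpos hγpos hsum (fun F =>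
        F.isDiagonalizedBy_of_even_of_even hβe hγe (.inr ⟨k₀, ⟨0, hk₀'⟩⟩) k₀) hdvd ?_
      have : 0 < q := k₀.pos
      have hXpos : 0 < Fintype.card (NonLast β γ) :=
        Fintype.card_pos_iff.2 ⟨.inr ⟨k₀, ⟨0, hk₀'⟩⟩⟩
      rw [sum_singleton_ite, sum_singleton_ite, Fintype.card_fin,
        show n - q - p = Fintype.card (NonLast β γ) - 1 + 1 by omega,
        show replicate q 2 = replicate (q - 1 + 1) 2 by congr; omega, ← Multiset.coe_add,
        Multiset.coe_replicate, Multiset.coe_replicate, Multiset.replicate_succ,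
        Multiset.replicate_succ, ← Multiset.singleton_add, ← Multiset.singleton_add]
      abel
    · have hγo k : (γ k : ℤ) % 2 = 1 := by
        have := h3 k k₀
        omega
      refine hasSmithNormalForm_wRep hn₀ hβpos hγpos hsum (fun F =>
        F.isDiagonalizedBy_of_even_of_odd hβe hγo k₀) hdvd ?_
      simp only [Finset.sum_const, Finset.card_univ, Fintype.card_fin, Multiset.nsmul_singleton]
      rw [show n - q - p = Fintype.card (NonLast β γ) by omega, ← Multiset.coe_add,
        Multiset.coe_replicate, Multiset.coe_replicate]
  · obtain ⟨k₀, k₁, hk₀, hk₁⟩ : ∃ k₀ k₁, (γ k₀ : ℤ) % 2 = 0 ∧ (γ k₁ : ℤ) % 2 = 1 := by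
      obtain ⟨i, j, hij⟩ := h3
      rcases Nat.mod_two_eq_zero_or_one (γ i) with h | h
      · exact ⟨i, j, by omega, by omega⟩
      · exact ⟨j, i, by omega, by omega⟩
    have hne : k₁ ≠ k₀ := by
      rintro rfl
      omega
    refine hasSmithNormalForm_wRep hn₀ hβpos hγpos hsum (fun F =>
      F.isDiagonalizedBy_of_even_of_ne (gcdParts_gcd_two_eq_two h1) hk₀ hk₁) ?_ ?_
    · simp [pairwise_append, pairwise_replicate, mem_replicate]
    · rw [sum_singleton_ite_ite hne]
      simp only [Finset.sum_const, Finset.card_univ, Fintype.card_fin, Multiset.nsmul_singleton]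
      rw [show n - q - p = Fintype.card (NonLast β γ) by omega, ← Multiset.coe_add,
        ← Multiset.coe_add, Multiset.coe_replicate, Multiset.coe_replicate,
        Multiset.replicate_succ, ← Multiset.singleton_add, Multiset.coe_singleton]
      abel
  · obtain ⟨k₀⟩ := hq h2
    obtain ⟨i₀, hi₀⟩ := exists_odd_of_not_dvd_gcdParts (β := β) fun h => by
      rw [Nat.gcd_eq_right h] at h1
      omega
    refine hasSmithNormalForm_wRep hn₀ hβpos hγpos hsum (fun F =>
      F.isDiagonalizedBy_of_odd i₀ hi₀ k₀) ?_ ?_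
    · simp [pairwise_append, pairwise_replicate, mem_replicate]
    · rw [sum_singleton_ite, Fintype.card_fin]
      simp only [Finset.sum_const, Finset.card_univ, Multiset.nsmul_singleton]
      rw [show n - q - p = Fintype.card (NonLast β γ) by omega, ← Multiset.coe_add,
        Multiset.coe_replicate, Multiset.coe_replicate, Multiset.replicate_succ,
        ← Multiset.singleton_add]
      abel
  · obtain rfl := hq' h1
    obtain ⟨i₀, hi₀⟩ := hlast (by omega)
    -- The gcd divides `lastPart β` and `lastPart β - 2`, hence `2`.
    have hdvd₂ : Nat.gcd (gcdParts β) (lastPart β - 2) ∣ 2 := by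
      have ha : Nat.gcd (gcdParts β) (lastPart β - 2) ∣ lastPart β :=
        hi₀ ▸ (Nat.gcd_dvd_left _ _).trans (Finset.gcd_dvd (Finset.mem_univ i₀))
      have := Nat.dvd_sub ha (Nat.gcd_dvd_right (gcdParts β) (lastPart β - 2))
      rwa [Nat.sub_sub_self h2] at this
    have hgcd : Nat.gcd (gcdParts β) (lastPart β - 2) = 2 :=
      le_antisymm (Nat.le_of_dvd two_pos hdvd₂) h3
    have hβe : ∀ i, (β i : ℤ) % 2 = 0 := gcdParts_gcd_two_eq_two
      (Nat.gcd_eq_right (hgcd ▸ Nat.gcd_dvd_left (gcdParts β) (lastPart β - 2)))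
    have hi₀' : 0 < β i₀ - 1 := by omega
    rw [hgcd]
    refine hasSmithNormalForm_wRep hn₀ hβpos hγpos hsum (fun F =>
      F.isDiagonalizedBy_of_even_of_isEmpty hβe (.inl ⟨i₀, ⟨0, hi₀'⟩⟩) i₀) ?_ ?_
    · simp [pairwise_append, pairwise_replicate, mem_replicate]
    · rw [sum_singleton_ite, show n - p - 1 = Fintype.card (NonLast β γ) - 1 by omega,
        ← Multiset.coe_add, Multiset.coe_replicate, Multiset.coe_singleton]
      simp [add_comm]
  · obtain rfl := hq' h1
    obtain ⟨i₀, hi₀⟩ : ∃ i, (β i : ℤ) % 2 = 1 := by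
      by_contra! hodd
      have h2β : 2 ∣ gcdParts β := by
        by_contra h
        obtain ⟨i, hi⟩ := exists_odd_of_not_dvd_gcdParts h
        exact hodd i hi
      rcases h2 with h2 | ⟨h2, h3⟩
      · obtain ⟨i, hi⟩ := hlast h2.ge
        have := hodd i
        omega
      · obtain ⟨i, hi⟩ := hlast (by omega)
        have h4 : 2 ∣ lastPart β - 2 := by
          have := hodd i
          omega
        have := Nat.dvd_gcd h2β h4
        omega
    refine hasSmithNormalForm_wRep hn₀ hβpos hγpos hsum (fun F =>
      F.isDiagonalizedBy_of_odd_of_isEmpty i₀ hi₀) ?_ ?_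
    · simp [pairwise_append, pairwise_replicate, mem_replicate]
    · simp only [Finset.sum_const, Finset.card_univ, Fintype.card_fin, Multiset.nsmul_singleton]
      rw [show n - p = Fintype.card (NonLast β γ) by omega, Multiset.coe_replicate]
      simp
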